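/- **Theorem.** Let $\mathcal E$ be a finite-dimensional complex Hilbert space, let $Q=Q^*$ and $L\ge 0$ be operators on $\mathcal E$, and let $\Sigma$ be a nondecreasing operator-valued function on $\mathbb R$ (its increments $\Sigma(t)-\Sigma(s)$, $s\le t$, are nonnegative operators on $\mathcal E$) such that $\int_{\mathbb R}\frac{(d\Sigma(t)x,x)}{1+t^2}<\infty$ for all $x\in\mathcal E$. Let $V$ be the matrix-valued Herglotz–Nevanlinna function $$V(z)=Q+zL+\int_{\mathbb R}\Big(\frac1{t-z}-\frac t{1+t^2}\Big)\,d\Sigma(t),\qquad z\in\mathbb C\setminus\mathbb R.$$ Then $V$ is the transfer function of a $\Delta_+$-system (impedance system). That is, there are a Hilbert space $\mathcal H$, a closed (not necessarily densely defined) Hermitian operator $A$ in $\mathcal H$, and operators $\mathbb D\in[\mathcal H_+,\mathcal H_-]$, $F_+\in[\mathcal H_+,\mathcal H_+]$ and $K\in[\mathcal E,\mathcal H_-]$ satisfying (i)–(iv) below, such that $\mathbb C\setminus\mathbb R\subset\rho(\mathbb D,F_+,K)$ and $$V(z)=K^*(\mathbb D-zF_+)^{-1}K,\qquad z\in\mathbb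 C\setminus\mathbb R.$$ Here $[X,Y]$ denotes the bounded linear operators from $X$ to $Y$. Let $A^*:\mathcal H\to\mathcal H_0$ be the adjoint of $A$ regarded as an operator from $\mathcal H_0=\overline{\operatorname{dom}A}$ into $\mathcal H$. The space $\mathcal H_+$ is $\operatorname{dom}A^*$ with inner product $(f,g)_+=(f,g)+(A^*f,A^*g)$, and $\mathcal H_-\supset\mathcal H\supset\mathcal H_+$ is the space of continuous conjugate-linear functionals on $\mathcal H_+$ with the dual norm, where $h\in\mathcal H$ is identified with $f\mapsto(h,f)$. The operator $K^*\in[\mathcal H_+,\mathcal E]$ is the adjoint of $K$ with respect to the pairing of $\mathcal H_-$ and $\mathcal H_+$. The conditions are: - (i) $\mathbb D$ is a self-adjoint bi-extension of $A$: $A\subset\mathbb D$, $\mathbb D=\mathbb D^*$, and the operator $\{\{x,\mathbb Dx\}: x\in\mathcal H_+,\ \mathbb Dx\in\mathcal H\}$ is a self-adjoint extension of $A$ in $\mathcal H$; - (ii) $K$ is injective; - (iii) $F_+$ is an orthogonal projection in $\mathcal H_+$ and is the restriction to $\mathcal H_+$ of an orthogonal projection in $\mathcal H$; - (iv) the set $\rho(\mathbb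 D,F_+,K)$ is open, where $\rho(\mathbb D,F_+,K)$ consists of all $z\in\mathbb C$ such that $\mathbb D-zF_+:\mathcal H_+\to\mathcal H_-$ is injective, its range contains $\mathcal H$ and $\operatorname{ran}K$, and its inverse is continuous on $\mathcal H+\operatorname{ran}K$ from the norm of $\mathcal H_-$ to the norm of $\mathcal H$. -/

import Mathlib

open MeasureTheory
open scoped InnerProductSpace ComplexConjugate

universe u v

noncomputable section

namespace Realization

/-! ### Nondecreasing matrix functions and Stieltjes integrals -/

section Stieltjes

variable {E : Type u} [NormedAddCommGroup E] [InnerProductSpace ℂ E]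

/-- `S` is nondecreasing: its increments are nonnegative operators. -/
def IsNondecreasing (S : ℝ → E →L[ℂ] E) : Prop :=
  ∀ s t : ℝ, s ≤ t → (S t - S s).IsPositive

theorem IsNondecreasing.monotone_form {S : ℝ → E →L[ℂ] E} (hS : IsNondecreasing S) (x : E) :
    Monotone fun t : ℝ => (⟪x, S t x⟫_ℂ).re := by
  intro s t hst
  have h := (hS s t hst).re_inner_nonneg_right x
  simp only [sub_apply, inner_sub_right, map_sub, sub_nonneg] at h
  exact h

/-- The Lebesgue–Stieltjes measure `d(S(t)x, x)` on the line. -/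
def quadMeasure {S : ℝ → E →L[ℂ] E} (hS : IsNondecreasing S) (x : E) : Measure ℝ :=
  (hS.monotone_form x).stieltjesFunction.measure

/-- The condition `∫ (dS(t)x, x) / (1 + t²) < ∞` for all `x`. -/
def FiniteNevanlinnaMass {S : ℝ → E →L[ℂ] E} (hS : IsNondecreasing S) : Prop :=
  ∀ x : E, ∫⁻ t : ℝ, ENNReal.ofReal (1 / (1 + t ^ 2)) ∂(quadMeasure hS x) < ⊤

/-- The scalar integral `∫ φ(t) d(S(t)x, y)` (linear in `x`, conjugate-linear in `y`),
where the complex measure `d(S(t)x, y)` is expressed by polarization. -/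
def sesqIntegral {S : ℝ → E →L[ℂ] E} (hS : IsNondecreasing S) (φ : ℝ → ℂ) (x y : E) : ℂ :=
  (1 / 4 : ℂ) *
    ((∫ t, φ t ∂(quadMeasure hS (x + y))) - (∫ t, φ t ∂(quadMeasure hS (x - y)))
      + Complex.I * (∫ t, φ t ∂(quadMeasure hS (x + Complex.I • y)))
      - Complex.I * (∫ t, φ t ∂(quadMeasure hS (x - Complex.I • y))))

/-- The matrix-valued integral `∫ φ(t) dS(t)`, computed entrywise in an orthonormal basis. -/
def opIntegral [FiniteDimensional ℂ E] {S : ℝ → E →L[ℂ] E} (hS : IsNondecreasing S)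
    (φ : ℝ → ℂ) : E →L[ℂ] E :=
  ∑ i, ∑ j, sesqIntegral hS φ (stdOrthonormalBasis ℂ E j) (stdOrthonormalBasis ℂ E i) •
    InnerProductSpace.rankOne ℂ (stdOrthonormalBasis ℂ E i) (stdOrthonormalBasis ℂ E j)

/-- The Nevanlinna kernel `1/(t - z) - t/(1 + t²)`. -/
def nevanlinnaKernel (z : ℂ) (t : ℝ) : ℂ :=
  1 / ((t : ℂ) - z) - (t : ℂ) / (1 + (t : ℂ) ^ 2)

end Stieltjes

/-! ### The rigged Hilbert space of a closed Hermitian operator -/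

section Rigged

variable {H : Type v} [NormedAddCommGroup H] [InnerProductSpace ℂ H]

/-- `A`, regarded as a (densely defined) operator from the closure `H₀` of its domain into `H`. -/
def fromClosure (A : H →ₗ.[ℂ] H) : A.domain.topologicalClosure →ₗ.[ℂ] H where
  domain := A.domain.comap A.domain.topologicalClosure.subtype
  toFun := A.toFun.comp (A.domain.topologicalClosure.subtype.restrict fun _ hx => hx)

variable [CompleteSpace H]

/-- The adjoint of `A : H₀ → H`, an operator from `H` into `H₀`. -/
def adj (A : H →ₗ.[ℂ] H) : H →ₗ.[ℂ] A.domain.topologicalClosure :=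
  haveI : CompleteSpace A.domain.topologicalClosure :=
    A.domain.isClosed_topologicalClosure.completeSpace_coe
  (fromClosure A).adjoint

/-- The space `H₊ = dom A*`; its inner product is the graph inner product. -/
def HPlus (A : H →ₗ.[ℂ] H) : Type v := (adj A).domain

namespace HPlus

variable (A : H →ₗ.[ℂ] H)

instance : AddCommGroup (HPlus A) := inferInstanceAs (AddCommGroup (adj A).domain)

instance : Module ℂ (HPlus A) := inferInstanceAs (Module ℂ (adj A).domain)

/-- The inclusion `H₊ ⊂ H` as a linear map. -/
def inclₗ : HPlus A →ₗ[ℂ] H := (adj A).domain.subtype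

/-- `A*` as a linear map on `H₊`. -/
def adjₗ : HPlus A →ₗ[ℂ] A.domain.topologicalClosure := (adj A).toFun

/-- The graph inner product `(f, g)₊ = (f, g) + (A* f, A* g)`. -/
@[reducible]
def core : InnerProductSpace.Core ℂ (HPlus A) where
  inner f g := ⟪inclₗ A f, inclₗ A g⟫_ℂ + ⟪adjₗ A f, adjₗ A g⟫_ℂ
  conj_inner_symm f g := by simp only [map_add, inner_conj_symm]
  re_inner_nonneg f := by
    rw [map_add]
    exact add_nonneg inner_self_nonneg inner_self_nonneg
  add_left f g h := by
    simp only [map_add, inner_add_left]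
    ring
  smul_left f g c := by
    simp only [map_smul, inner_smul_left]
    ring
  definite f hf := by
    have h1 : (0 : ℝ) ≤ RCLike.re ⟪inclₗ A f, inclₗ A f⟫_ℂ := inner_self_nonneg
    have h2 : (0 : ℝ) ≤ RCLike.re ⟪adjₗ A f, adjₗ A f⟫_ℂ := inner_self_nonneg
    have h3 := congrArg (RCLike.re : ℂ → ℝ) hf
    rw [map_add, map_zero] at h3
    have h4 : RCLike.re ⟪inclₗ A f, inclₗ A f⟫_ℂ = 0 := by linarith
    rw [inner_self_eq_norm_sq (𝕜 := ℂ), sq_eq_zero_iff, norm_eq_zero] at h4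
    exact Subtype.ext h4

instance : NormedAddCommGroup (HPlus A) := (core A).toNormedAddCommGroup

instance : InnerProductSpace ℂ (HPlus A) := InnerProductSpace.ofCore (core A).toCore

theorem inner_def (f g : HPlus A) :
    ⟪f, g⟫_ℂ = ⟪inclₗ A f, inclₗ A g⟫_ℂ + ⟪adjₗ A f, adjₗ A g⟫_ℂ := rfl

theorem norm_inclₗ_le (f : HPlus A) : ‖inclₗ A f‖ ≤ ‖f‖ := by
  have h := congrArg (RCLike.re : ℂ → ℝ) (inner_def A f f)
  rw [map_add, inner_self_eq_norm_sq (𝕜 := ℂ), inner_self_eq_norm_sq (𝕜 := ℂ),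
    inner_self_eq_norm_sq (𝕜 := ℂ)] at h
  exact le_of_sq_le_sq (by nlinarith [sq_nonneg ‖adjₗ A f‖]) (norm_nonneg _)

/-- The continuous inclusion `H₊ ⊂ H`. -/
def incl : HPlus A →L[ℂ] H :=
  (inclₗ A).mkContinuous 1 fun f => by simpa using norm_inclₗ_le A f

end HPlus

/-- The space `H₋` of continuous conjugate-linear functionals on `H₊`, with the dual norm. The
pairing `(α, f)` of `α ∈ H₋` with `f ∈ H₊` is `α f`. -/
abbrev HMinus (A : H →ₗ.[ℂ] H) : Type v := HPlus A →L⋆[ℂ] ℂ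

/-- The inclusion `H ⊂ H₋`: the vector `h` is the functional `f ↦ (h, f)`. -/
def embed (A : H →ₗ.[ℂ] H) : H →L[ℂ] HMinus A :=
  ((innerSL ℂ : H →L⋆[ℂ] H →L[ℂ] ℂ).comp (HPlus.incl A)).flip

/-- `{ {x, 𝔻x} : x ∈ H₊, 𝔻x ∈ H }`, as a subspace of `H × H`. -/
def innerGraph {A : H →ₗ.[ℂ] H} (D : HPlus A →L[ℂ] HMinus A) : Submodule ℂ (H × H) where
  carrier := {p | ∃ f : HPlus A, HPlus.incl A f = p.1 ∧ D f = embed A p.2}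
  zero_mem' := ⟨0, by simp⟩
  add_mem' := by
    rintro p q ⟨f, hf, hDf⟩ ⟨g, hg, hDg⟩
    exact ⟨f + g, by simp [hf, hg], by simp [hDf, hDg]⟩
  smul_mem' := by
    rintro c p ⟨f, hf, hDf⟩
    exact ⟨c • f, by simp [hf], by simp [hDf]⟩

/-- `𝔻 ∈ [H₊, H₋]` is a self-adjoint bi-extension of `A`. As `𝔻 = 𝔻*`, the
two conditions `A ⊂ 𝔻` and `A ⊂ 𝔻*` of a bi-extension coincide. -/
structure IsSelfAdjointBiExtension (A : H →ₗ.[ℂ] H) (D : HPlus A →L[ℂ] HMinus A) : Prop where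
  /-- `A ⊂ 𝔻` -/
  extends_op : ∀ x : A.domain, ∃ f : HPlus A, HPlus.incl A f = x ∧ D f = embed A (A x)
  /-- `𝔻 = 𝔻*`, that is, `(𝔻f, g) = (f, 𝔻g)` for all `f, g ∈ H₊`. -/
  symm : ∀ f g : HPlus A, D f g = conj (D g f)
  /-- the part of `𝔻` in `H` is a self-adjoint operator in `H` extending `A` -/
  selfAdjoint_part : ∃ T : H →ₗ.[ℂ] H, T.graph = innerGraph D ∧ IsSelfAdjoint T ∧ A ≤ T

/-- `F ∈ [H₊, H₊]` is an orthogonal projection in `H₊` and in `H`, i.e. it is an orthogonal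
projection in `H₊` and the restriction to `H₊` of an orthogonal projection in `H`. -/
def IsOrthogonalProjectionInBoth {A : H →ₗ.[ℂ] H} (F : HPlus A →L[ℂ] HPlus A) : Prop :=
  (F : HPlus A →ₗ[ℂ] HPlus A).IsSymmetricProjection ∧
    ∃ P : H →L[ℂ] H, IsStarProjection P ∧
      ∀ f : HPlus A, HPlus.incl A (F f) = P (HPlus.incl A f)

/-- The operator `𝔻 - zF₊ ∈ [H₊, H₋]`. -/
def pencil {A : H →ₗ.[ℂ] H} (D : HPlus A →L[ℂ] HMinus A) (F : HPlus A →L[ℂ] HPlus A) (z : ℂ) :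
    HPlus A →L[ℂ] HMinus A :=
  D - z • (embed A ∘L HPlus.incl A ∘L F)

variable {E : Type u} [NormedAddCommGroup E] [InnerProductSpace ℂ E]

/-- The set `ρ(𝔻, F₊, K)` of all `z` for which `(𝔻 - zF₊)⁻¹` exists on `H ∪ ran K`,
hence on the subspace `H + ran K` of `H₋`, and is continuous there from the norm of `H₋` to the
norm of `H`. -/
def rho {A : H →ₗ.[ℂ] H} (D : HPlus A →L[ℂ] HMinus A) (F : HPlus A →L[ℂ] HPlus A)
    (K : E →L[ℂ] HMinus A) : Set ℂ :=
  {z | Function.Injective (pencil D F z) ∧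
    (∀ h : H, ∃ f, pencil D F z f = embed A h) ∧
    (∀ e : E, ∃ f, pencil D F z f = K e) ∧
    ∃ C : ℝ, ∀ (f : HPlus A) (h : H) (e : E), pencil D F z f = embed A h + K e →
      ‖HPlus.incl A f‖ ≤ C * ‖embed A h + K e‖}

/-- The data `A`, `𝔻`, `F₊`, `K` form a `Δ₊`-system (impedance system)
`(𝔻 - zF₊)x = Kφ₋`, `φ₊ = K*x`. -/
structure IsDeltaPlusSystem (A : H →ₗ.[ℂ] H) (D : HPlus A →L[ℂ] HMinus A)
    (F : HPlus A →L[ℂ] HPlus A) (K : E →L[ℂ] HMinus A) : Prop where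
  closed_op : A.IsClosed
  hermitian_op : A.IsFormalAdjoint A
  biExtension : IsSelfAdjointBiExtension A D
  injective_K : Function.Injective K
  projection : IsOrthogonalProjectionInBoth F
  isOpen_rho : IsOpen (rho D F K)

variable [FiniteDimensional ℂ E]

/-- The adjoint `K* ∈ [H₊, E]`, determined by `(Ke, f) = (e, K*f)_E`. -/
def dualAdjoint {A : H →ₗ.[ℂ] H} (K : E →L[ℂ] HMinus A) : HPlus A →L[ℂ] E :=
  haveI : CompleteSpace E := FiniteDimensional.complete ℂ E
  ((InnerProductSpace.toDual ℂ E).symm.toContinuousLinearEquiv :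
    (E →L[ℂ] ℂ) →L⋆[ℂ] E).comp K.flip

/-- The transfer function `K*(𝔻 - zF₊)⁻¹K`, meaningful for `z ∈ ρ(𝔻, F₊, K)`. -/
def transfer {A : H →ₗ.[ℂ] H} (D : HPlus A →L[ℂ] HMinus A) (F : HPlus A →L[ℂ] HPlus A)
    (K : E →L[ℂ] HMinus A) (z : ℂ) (e : E) : E :=
  dualAdjoint K (Function.invFun (pencil D F z) (K e))

end Rigged

end Realization

end

open Realization

noncomputable section

namespace Realization

/-! With respect to its trace measure `μ`, the operator measure `dΣ` has a nonnegative density. The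
square root `β` of this density turns the integral term into the form `∫ k_z (βx, βy) dμ`, where
`k_z` is the Nevanlinna kernel (`quadMeasure_eq_withDensity`, `inner_opIntegral`). If every `βe`
were in `L²(μ; E)`, this would be `B*(T - z)⁻¹B` up to a constant, with `T` multiplication by `t`
and `Be = βe`.

In general only `βe / √(1 + t²)` is square integrable. So `E` is split into the regular vectors, for
which `βe ∈ L²`, and their orthogonal complement `N`. For `n ∈ N` one has formally `βn = T J n + J'
n`, with `J n = tβn/(1+t²)` and `J' n = βn/(1+t²)` in `L²`, and `J n ∉ dom T` unless `n = 0`. Let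
`A` be `T` restricted by the finitely many conditions `J* T x + J'* x = 0`. Then `dom A*` gains
exactly the directions `J n` (and the auxiliary summand `W` below). The functional `g ↦ (J n, A* g)
+ (J' n, g)` gives `βn` a meaning in `H₋`, and it lies outside `H` when `n ≠ 0`
(`eq_zero_of_K₀_eq_embed`). Adding to `A* f` this functional of the singular coefficient of `f`
extends `T` to `H₊` symmetrically, and vectors mapped into `H` have no singular coefficient
(`innerGraph_D`).

Regular inputs meet `1/(t - z)` instead of `k_z`. The surplus `t/(1 + t²)` contributes a Hermitian
constant `regConst`, which is subtracted from `Q` (`inner_nevanlinnaModel`).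

The term `Q + zL` comes from a bounded pencil on `W = E⁴` whose inverse is polynomial in `z`. This
summand is orthogonal to `dom A`, which is why `A` is not densely defined when `E ≠ 0`. It makes `K`
injective and does not affect `ρ`, so `ρ` is the resolvent set of `T` (`mem_rho_iff`): it is open
and contains every nonreal `z`. -/

/-- An operator is self-adjoint if its graph is maximal symmetric in the sense of relations and
its domain has trivial orthogonal complement. -/
theorem isSelfAdjoint_of_graph {G : Type*} [NormedAddCommGroup G] [InnerProductSpace ℂ G]
    [CompleteSpace G] {T : G →ₗ.[ℂ] G}
    (hsymm : ∀ a b y v, (a, b) ∈ T.graph → (y, v) ∈ T.graph → ⟪b, y⟫_ℂ = ⟪a, v⟫_ℂ)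
    (hmax : ∀ y v, (∀ a b, (a, b) ∈ T.graph → ⟪b, y⟫_ℂ = ⟪a, v⟫_ℂ) → (y, v) ∈ T.graph)
    (hdom : ∀ y, (∀ a b, (a, b) ∈ T.graph → ⟪a, y⟫_ℂ = 0) → y = 0) : IsSelfAdjoint T := by
  have hdense : Dense (T.domain : Set G) := by
    rw [Submodule.dense_iff_topologicalClosure_eq_top, Submodule.topologicalClosure_eq_top_iff,
      Submodule.eq_bot_iff]
    exact fun y hy => hdom y fun a b hab =>
      (Submodule.mem_orthogonal _ _).1 hy _ (LinearPMap.mem_domain_of_mem_graph hab)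
  rw [LinearPMap.isSelfAdjoint_def]
  apply LinearPMap.eq_of_eq_graph
  rw [LinearPMap.adjoint_graph_eq_graph_adjoint hdense]
  ext ⟨y, v⟩
  simp only [Submodule.mem_adjoint_iff, sub_eq_zero]
  exact ⟨hmax y v, fun h a b hab => hsymm a b y v hab h⟩

/-! ### The spaces `H₊ ⊂ H ⊂ H₋` in terms of graphs. -/

section RiggedGeneral

variable {H : Type v} [NormedAddCommGroup H] [InnerProductSpace ℂ H]

theorem dense_fromClosure_domain (A : H →ₗ.[ℂ] H) : 
    Dense ((fromClosure A).domain : Set A.domain.topologicalClosure) := by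
  intro x
  rw [closure_subtype]
  have hx : (x : H) ∈ closure (A.domain : Set H) := x.2
  convert hx using 2
  ext y
  simp only [Set.mem_image, SetLike.mem_coe, Subtype.exists, exists_and_right, exists_eq_right]
  exact ⟨fun ⟨_, h⟩ => h, fun h => ⟨subset_closure h, h⟩⟩

variable [CompleteSpace H]

theorem HPlus.incl_injective (A : H →ₗ.[ℂ] H) : Function.Injective (HPlus.incl A) :=
  fun _ _ h => Subtype.ext h

/-- `A*` as a bounded operator from `H₊` into `H`. -/
def HPlus.adjL (A : H →ₗ.[ℂ] H) : HPlus A →L[ℂ] H :=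
  ((A.domain.topologicalClosure.subtype).comp (HPlus.adjₗ A)).mkContinuous 1 fun f => by
    have h := congrArg (RCLike.re : ℂ → ℝ) (HPlus.inner_def A f f)
    rw [map_add, inner_self_eq_norm_sq (𝕜 := ℂ), inner_self_eq_norm_sq (𝕜 := ℂ),
      inner_self_eq_norm_sq (𝕜 := ℂ)] at h
    rw [one_mul]
    exact le_of_sq_le_sq (by
      change ‖HPlus.adjₗ A f‖ ^ 2 ≤ _
      nlinarith [sq_nonneg ‖HPlus.inclₗ A f‖]) (norm_nonneg _)

theorem HPlus.inner_eq (A : H →ₗ.[ℂ] H) (f g : HPlus A) :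
    ⟪f, g⟫_ℂ = ⟪HPlus.incl A f, HPlus.incl A g⟫_ℂ + ⟪HPlus.adjL A f, HPlus.adjL A g⟫_ℂ := rfl

theorem HPlus.norm_sq_eq (A : H →ₗ.[ℂ] H) (f : HPlus A) :
    ‖f‖ ^ 2 = ‖HPlus.incl A f‖ ^ 2 + ‖HPlus.adjL A f‖ ^ 2 := by
  have h := congrArg (RCLike.re : ℂ → ℝ) (HPlus.inner_eq A f f)
  rwa [map_add, inner_self_eq_norm_sq (𝕜 := ℂ), inner_self_eq_norm_sq (𝕜 := ℂ),
    inner_self_eq_norm_sq (𝕜 := ℂ)] at h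

theorem HPlus.adjL_mem (A : H →ₗ.[ℂ] H) (f : HPlus A) :
    HPlus.adjL A f ∈ A.domain.topologicalClosure := (HPlus.adjₗ A f).2

theorem HPlus.inner_graph {A : H →ₗ.[ℂ] H} (f : HPlus A) {a b : H} (hab : (a, b) ∈ A.graph) :
    ⟪b, HPlus.incl A f⟫_ℂ = ⟪a, HPlus.adjL A f⟫_ℂ := by
  have : CompleteSpace A.domain.topologicalClosure :=
    A.domain.isClosed_topologicalClosure.completeSpace_coe
  rw [LinearPMap.mem_graph_iff] at hab
  obtain ⟨y, rfl, rfl⟩ := hab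
  have h := (LinearPMap.adjoint_isFormalAdjoint (dense_fromClosure_domain A)).symm
    ⟨⟨(y : H), subset_closure y.2⟩, y.2⟩ f
  exact h

/-- This is how elements of `H₊` are produced later. The value `g` must lie in `H₀` because `A*`
maps into `H₀`; that requirement makes it unique. -/
theorem HPlus.exists_of_inner {A : H →ₗ.[ℂ] H} {h g : H} (hg : g ∈ A.domain.topologicalClosure)
    (hgr : ∀ a b : H, (a, b) ∈ A.graph → ⟪b, h⟫_ℂ = ⟪a, g⟫_ℂ) :
    ∃ f : HPlus A, HPlus.incl A f = h ∧ HPlus.adjL A f = g := by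
  have : CompleteSpace A.domain.topologicalClosure :=
    A.domain.isClosed_topologicalClosure.completeSpace_coe
  have key : ∀ x : (fromClosure A).domain,
      ⟪(⟨g, hg⟩ : A.domain.topologicalClosure), x⟫_ℂ = ⟪h, fromClosure A x⟫_ℂ := by
    intro x
    have := hgr _ _ (LinearPMap.mem_graph A ⟨x, x.2⟩)
    rw [← inner_conj_symm, ← inner_conj_symm h]
    exact congrArg conj this.symm
  have hm : h ∈ (fromClosure A).adjoint.domain :=
    LinearPMap.mem_adjoint_domain_of_exists _ ⟨_, key⟩
  refine ⟨⟨h, hm⟩, rfl, ?_⟩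
  exact congrArg Subtype.val
    (LinearPMap.adjoint_apply_eq (dense_fromClosure_domain A) ⟨h, hm⟩ key)

theorem embed_apply (A : H →ₗ.[ℂ] H) (h : H) (f : HPlus A) :
    embed A h f = ⟪HPlus.incl A f, h⟫_ℂ := rfl

theorem norm_embed_le (A : H →ₗ.[ℂ] H) (h : H) : ‖embed A h‖ ≤ ‖h‖ := by
  refine ContinuousLinearMap.opNorm_le_bound _ (norm_nonneg _) fun f => ?_
  rw [embed_apply, mul_comm]
  exact (norm_inner_le_norm _ _).trans
    (mul_le_mul_of_nonneg_right (HPlus.norm_inclₗ_le A f) (norm_nonneg _))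

end RiggedGeneral

/-! ### The abstract model: the operator `A`, its bi-extension and the projection. -/

section Model

open ContinuousLinearMap (adjoint)

/-- Data for a rigged model on `G ⊕ W`: a self-adjoint operator `T` in `G` with finitely many
singular directions `J n ∉ dom T`, and a bounded Hermitian pencil `D₂ - zF₂` in `W`. -/
structure RiggedModel (G N W : Type*)
    [NormedAddCommGroup G] [InnerProductSpace ℂ G] [CompleteSpace G]
    [NormedAddCommGroup N] [InnerProductSpace ℂ N]
    [NormedAddCommGroup W] [InnerProductSpace ℂ W] [CompleteSpace W] where
  /-- the self-adjoint operator in `G` -/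
  T : G →ₗ.[ℂ] G
  selfAdjoint : IsSelfAdjoint T
  /-- the singular directions -/
  J : N →L[ℂ] G
  /-- the regular companions of the singular directions -/
  J' : N →L[ℂ] G
  inner_J_J' : ∀ m n, ⟪J m, J' n⟫_ℂ = ⟪J' m, J n⟫_ℂ
  singular : ∀ n, J n ∈ T.domain → n = 0
  /-- the main operator of the bounded pencil -/
  D₂ : W →L[ℂ] W
  symm_D₂ : ∀ x y, ⟪D₂ x, y⟫_ℂ = ⟪x, D₂ y⟫_ℂ
  /-- the projection of the bounded pencil -/
  F₂ : W →L[ℂ] W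
  projection_F₂ : IsStarProjection F₂

namespace RiggedModel

variable {G N W : Type v}
  [NormedAddCommGroup G] [InnerProductSpace ℂ G] [CompleteSpace G]
  [NormedAddCommGroup N] [InnerProductSpace ℂ N]
  [NormedAddCommGroup W] [InnerProductSpace ℂ W] [CompleteSpace W]
  (M : RiggedModel G N W)

/-- `T = T*` read on graphs. Membership in `dom T` can then be proved by testing against the graph,
without handling domains. -/
theorem mem_T_graph_iff (y v : G) :
    (y, v) ∈ M.T.graph ↔ ∀ a b, (a, b) ∈ M.T.graph → ⟪b, y⟫_ℂ = ⟪a, v⟫_ℂ := by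
  have h := LinearPMap.adjoint_graph_eq_graph_adjoint M.selfAdjoint.dense_domain
  rw [LinearPMap.isSelfAdjoint_def.1 M.selfAdjoint] at h
  conv_lhs => rw [h]
  simp only [Submodule.mem_adjoint_iff, sub_eq_zero]

theorem inner_T {a b a' b' : G} (h : (a, b) ∈ M.T.graph) (h' : (a', b') ∈ M.T.graph) :
    ⟪b, a'⟫_ℂ = ⟪a, b'⟫_ℂ := (M.mem_T_graph_iff a' b').1 h' a b h

theorem T_single {b : G} (h : ((0 : G), b) ∈ M.T.graph) : b = 0 :=
  LinearPMap.graph_fst_eq_zero_snd _ h rfl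

theorem eq_zero_of_inner_domain {g : G} (h : ∀ a b, (a, b) ∈ M.T.graph → ⟪a, g⟫_ℂ = 0) :
    g = 0 := by
  refine M.T_single ((M.mem_T_graph_iff 0 g).2 fun a b hab => ?_)
  rw [inner_zero_right, h a b hab]

theorem isClosed_T_graph : IsClosed (M.T.graph : Set (G × G)) := M.selfAdjoint.isClosed

theorem singular_of_graph {n : N} {v : G} (h : (M.J n, v) ∈ M.T.graph) : n = 0 :=
  M.singular n (LinearPMap.mem_domain_of_mem_graph h)

/-- The boundary condition `J* T x + J'* x`. -/
def bdry [FiniteDimensional ℂ N] : M.T.graph →ₗ[ℂ] N :=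
  have : CompleteSpace N := FiniteDimensional.complete ℂ N
  ((adjoint M.J : G →ₗ[ℂ] N) ∘ₗ LinearMap.snd ℂ G G
    + (adjoint M.J' : G →ₗ[ℂ] N) ∘ₗ LinearMap.fst ℂ G G) ∘ₗ M.T.graph.subtype

theorem inner_bdry [FiniteDimensional ℂ N] (x : M.T.graph) (n : N) :
    ⟪M.bdry x, n⟫_ℂ = ⟪x.1.2, M.J n⟫_ℂ + ⟪x.1.1, M.J' n⟫_ℂ := by
  have : CompleteSpace N := FiniteDimensional.complete ℂ N
  simp [bdry, ContinuousLinearMap.adjoint_inner_left]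

/-- Functionals annihilating the kernel of the boundary map. -/
theorem exists_of_bdry_eq_zero [FiniteDimensional ℂ N] {f g : G}
    (h : ∀ x : M.T.graph, M.bdry x = 0 → ⟪x.1.2, f⟫_ℂ = ⟪x.1.1, g⟫_ℂ) :
    ∃ n : N, (f - M.J n, g + M.J' n) ∈ M.T.graph := by
  have : CompleteSpace N := FiniteDimensional.complete ℂ N
  let φ : M.T.graph →ₗ[ℂ] ℂ := ((innerSL ℂ f : G →ₗ[ℂ] ℂ) ∘ₗ LinearMap.snd ℂ G G
    - (innerSL ℂ g : G →ₗ[ℂ] ℂ) ∘ₗ LinearMap.fst ℂ G G) ∘ₗ M.T.graph.subtype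
  have hφ : ∀ x : M.T.graph, φ x = ⟪f, x.1.2⟫_ℂ - ⟪g, x.1.1⟫_ℂ := fun x => rfl
  have hker : LinearMap.ker M.bdry ≤ LinearMap.ker φ := by
    intro x hx
    rw [LinearMap.mem_ker, hφ, sub_eq_zero, ← inner_conj_symm, h x hx, inner_conj_symm]
  -- `φ` vanishes on the kernel of the boundary map, hence factors through it; the Riesz vector of
  -- the factor is the required `n`.
  obtain ⟨ψ, hψ⟩ : ∃ ψ : N →ₗ[ℂ] ℂ, ψ ∘ₗ M.bdry = φ := by
    have : φ ∈ LinearMap.range M.bdry.dualMap := by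
      rw [LinearMap.range_dualMap_eq_dualAnnihilator_ker, Submodule.mem_dualAnnihilator]
      exact fun w hw => hker hw
    obtain ⟨ψ, hψ⟩ := this
    exact ⟨ψ, hψ⟩
  let n : N := (InnerProductSpace.toDual ℂ N).symm (LinearMap.toContinuousLinearMap ψ)
  have hn : ∀ m, ⟪n, m⟫_ℂ = ψ m := fun m => by
    simp [n]
  refine ⟨n, (M.mem_T_graph_iff _ _).2 fun a b hab => ?_⟩
  have h1 : ψ (M.bdry ⟨(a, b), hab⟩) = φ ⟨(a, b), hab⟩ := LinearMap.congr_fun hψ _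
  rw [hφ, ← hn, ← inner_conj_symm, inner_bdry] at h1
  have h2 := congrArg conj h1
  simp only [map_add, map_sub, inner_conj_symm] at h2
  simp only [inner_sub_right, inner_add_right]
  linear_combination -h2

/-- A vector `n` orthogonal to the range puts `(J n, -J' n)` in the graph of `T* = T`, so `J n ∈ dom
T` and `n = 0`. -/
theorem bdry_surjective [FiniteDimensional ℂ N] : Function.Surjective M.bdry := by
  have : CompleteSpace N := FiniteDimensional.complete ℂ N
  rw [← LinearMap.range_eq_top, ← Submodule.orthogonal_eq_bot_iff, Submodule.eq_bot_iff]
  intro n hn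
  have : (M.J n, - M.J' n) ∈ M.T.graph := (M.mem_T_graph_iff _ _).2 fun a b hab => by
    have h := (Submodule.mem_orthogonal _ _).1 hn _ ⟨⟨(a, b), hab⟩, rfl⟩
    rw [inner_bdry] at h
    rw [inner_neg_right]
    linear_combination h
  exact M.singular_of_graph this

/-- The inclusion of `G` in `G ⊕ W`. -/
def inG (G W : Type*) [NormedAddCommGroup G] [InnerProductSpace ℂ G]
    [NormedAddCommGroup W] [InnerProductSpace ℂ W] : G →L[ℂ] WithLp 2 (G × W) :=
  (WithLp.prodContinuousLinearEquiv 2 ℂ G W).symm.toContinuousLinearMap ∘L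
    ContinuousLinearMap.inl ℂ G W

/-- The inclusion of `W` in `G ⊕ W`. -/
def inW (G W : Type*) [NormedAddCommGroup G] [InnerProductSpace ℂ G]
    [NormedAddCommGroup W] [InnerProductSpace ℂ W] : W →L[ℂ] WithLp 2 (G × W) :=
  (WithLp.prodContinuousLinearEquiv 2 ℂ G W).symm.toContinuousLinearMap ∘L
    ContinuousLinearMap.inr ℂ G W

section
variable {G W : Type*} [NormedAddCommGroup G] [InnerProductSpace ℂ G]
    [NormedAddCommGroup W] [InnerProductSpace ℂ W]

@[simp] theorem inG_fst (g : G) : (inG G W g).fst = g := rfl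
@[simp] theorem inG_snd (g : G) : (inG G W g).snd = 0 := rfl
@[simp] theorem inW_fst (w : W) : (inW G W w).fst = 0 := rfl
@[simp] theorem inW_snd (w : W) : (inW G W w).snd = w := rfl

theorem inner_inG (x : WithLp 2 (G × W)) (g : G) : ⟪x, inG G W g⟫_ℂ = ⟪x.fst, g⟫_ℂ := by
  rw [WithLp.prod_inner_apply]; simp

theorem inG_inner (x : WithLp 2 (G × W)) (g : G) : ⟪inG G W g, x⟫_ℂ = ⟪g, x.fst⟫_ℂ := by
  rw [WithLp.prod_inner_apply]; simp

theorem inner_inW (x : WithLp 2 (G × W)) (w : W) : ⟪x, inW G W w⟫_ℂ = ⟪x.snd, w⟫_ℂ := by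
  rw [WithLp.prod_inner_apply]; simp

theorem inW_inner (x : WithLp 2 (G × W)) (w : W) : ⟪inW G W w, x⟫_ℂ = ⟪w, x.snd⟫_ℂ := by
  rw [WithLp.prod_inner_apply]; simp

end

theorem prod_ext {G W : Type*} {x y : WithLp 2 (G × W)} (h₁ : x.fst = y.fst) (h₂ : x.snd = y.snd) : x = y :=
  (WithLp.equiv 2 (G × W)).injective (Prod.ext h₁ h₂)

/-- The graph of the self-adjoint operator `T ⊕ D₂`. -/
def fullGraph : Submodule ℂ (WithLp 2 (G × W) × WithLp 2 (G × W)) where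
  carrier := {p | (p.1.fst, p.2.fst) ∈ M.T.graph ∧ p.2.snd = M.D₂ p.1.snd}
  zero_mem' := ⟨M.T.graph.zero_mem, by simp⟩
  add_mem' := by
    rintro p q ⟨h1, h2⟩ ⟨h3, h4⟩
    exact ⟨M.T.graph.add_mem h1 h3, by simp [h2, h4]⟩
  smul_mem' := by
    rintro c p ⟨h1, h2⟩
    exact ⟨M.T.graph.smul_mem c h1, by simp [h2]⟩

/-- The graph of the restriction of `T` to the kernel of the boundary map. -/
def minGraph [FiniteDimensional ℂ N] : Submodule ℂ (WithLp 2 (G × W) × WithLp 2 (G × W)) :=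
  (LinearMap.ker M.bdry).map
    ((inG G W : G →ₗ[ℂ] WithLp 2 (G × W)).prodMap (inG G W : G →ₗ[ℂ] WithLp 2 (G × W)) ∘ₗ
      M.T.graph.subtype)

theorem mem_minGraph [FiniteDimensional ℂ N] {p : WithLp 2 (G × W) × WithLp 2 (G × W)} :
    p ∈ M.minGraph ↔ ∃ x : M.T.graph, M.bdry x = 0 ∧ p.1 = inG G W x.1.1 ∧ p.2 = inG G W x.1.2 := by
  simp only [minGraph, Submodule.mem_map, LinearMap.mem_ker]
  constructor
  · rintro ⟨x, hx, rfl⟩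
    exact ⟨x, hx, rfl, rfl⟩
  · rintro ⟨x, hx, h1, h2⟩
    exact ⟨x, hx, Prod.ext h1.symm h2.symm⟩

/-- The self-adjoint operator `T ⊕ D₂`. -/
def full : WithLp 2 (G × W) →ₗ.[ℂ] WithLp 2 (G × W) := M.fullGraph.toLinearPMap

theorem graph_full : M.full.graph = M.fullGraph := by
  refine Submodule.toLinearPMap_graph_eq _ fun p hp h0 => ?_
  obtain ⟨h1, h2⟩ := hp
  rw [h0] at h1 h2
  exact prod_ext (M.T_single h1) (by simpa using h2)

theorem isSelfAdjoint_full : IsSelfAdjoint M.full := by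
  refine isSelfAdjoint_of_graph ?_ ?_ ?_
  · rw [graph_full]
    rintro a b y v ⟨h3, h4⟩ ⟨h1, h2⟩
    simp only at h1 h2 h3 h4
    rw [WithLp.prod_inner_apply, WithLp.prod_inner_apply]
    change ⟪b.fst, y.fst⟫_ℂ + ⟪b.snd, y.snd⟫_ℂ = ⟪a.fst, v.fst⟫_ℂ + ⟪a.snd, v.snd⟫_ℂ
    rw [M.inner_T h3 h1, h4, h2, M.symm_D₂]
  · rw [graph_full]
    intro y v h
    refine ⟨(M.mem_T_graph_iff _ _).2 fun a b hab => ?_, ext_inner_left ℂ fun w => ?_⟩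
    · have := h (inG G W a) (inG G W b) ⟨hab, by simp⟩
      rwa [inG_inner, inG_inner] at this
    · have := h (inW G W w) (inW G W (M.D₂ w)) ⟨M.T.graph.zero_mem, by simp⟩
      rw [inW_inner, inW_inner, M.symm_D₂] at this
      exact this.symm
  · rw [graph_full]
    intro y hy
    refine prod_ext (M.eq_zero_of_inner_domain fun a b hab => ?_) ?_
    · have := hy (inG G W a) (inG G W b) ⟨hab, by simp⟩
      rwa [inG_inner] at this
    · have := hy (inW G W y.snd) (inW G W (M.D₂ y.snd)) ⟨M.T.graph.zero_mem, by simp⟩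
      rwa [inW_inner, inner_self_eq_zero] at this

/-- The projection `1 ⊕ F₂`. -/
def P : WithLp 2 (G × W) →L[ℂ] WithLp 2 (G × W) :=
  inG G W ∘L WithLp.fstL 2 ℂ G W + inW G W ∘L M.F₂ ∘L WithLp.sndL 2 ℂ G W

@[simp] theorem P_fst (x : WithLp 2 (G × W)) : (M.P x).fst = x.fst := by simp [P]
@[simp] theorem P_snd (x : WithLp 2 (G × W)) : (M.P x).snd = M.F₂ x.snd := by simp [P]

theorem F₂_idem (x : W) : M.F₂ (M.F₂ x) = M.F₂ x :=
  DFunLike.congr_fun M.projection_F₂.isIdempotentElem x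

theorem F₂_symm (x y : W) : ⟪M.F₂ x, y⟫_ℂ = ⟪x, M.F₂ y⟫_ℂ :=
  M.projection_F₂.isSelfAdjoint.isSymmetric x y

theorem P_symm (x y : WithLp 2 (G × W)) : ⟪M.P x, y⟫_ℂ = ⟪x, M.P y⟫_ℂ := by
  rw [WithLp.prod_inner_apply, WithLp.prod_inner_apply]
  change ⟪(M.P x).fst, y.fst⟫_ℂ + ⟪(M.P x).snd, y.snd⟫_ℂ =
    ⟪x.fst, (M.P y).fst⟫_ℂ + ⟪x.snd, (M.P y).snd⟫_ℂ
  simp [F₂_symm]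

theorem P_idem (x : WithLp 2 (G × W)) : M.P (M.P x) = M.P x :=
  prod_ext (by simp) (by simp [F₂_idem])

variable [FiniteDimensional ℂ N]

/-- The closed Hermitian operator of the model. -/
def A : WithLp 2 (G × W) →ₗ.[ℂ] WithLp 2 (G × W) := M.minGraph.toLinearPMap

theorem graph_A : M.A.graph = M.minGraph := by
  refine Submodule.toLinearPMap_graph_eq _ fun p hp h0 => ?_
  obtain ⟨x, -, h1, h2⟩ := M.mem_minGraph.1 hp
  have hx : x.1.1 = 0 := by
    have := congrArg WithLp.fst (h1.symm.trans h0); simpa using this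
  have hx2 : x.1.2 = 0 := M.T_single (by have := x.2; rw [← hx]; exact this)
  rw [h2, hx2, map_zero]

theorem minGraph_le : M.minGraph ≤ M.fullGraph := by
  intro p hp
  obtain ⟨x, -, h1, h2⟩ := M.mem_minGraph.1 hp
  refine ⟨?_, ?_⟩
  · rw [h1, h2]; exact x.2
  · rw [h1, h2]; simp

theorem A_le_full : M.A ≤ M.full :=
  LinearPMap.le_of_le_graph (by rw [graph_A, graph_full]; exact M.minGraph_le)

theorem isFormalAdjoint_A : M.A.IsFormalAdjoint M.A := by
  intro x y
  have hx := LinearPMap.mem_graph M.A x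
  have hy := LinearPMap.mem_graph M.A y
  rw [graph_A, mem_minGraph] at hx hy
  obtain ⟨a, -, h1, h2⟩ := hx
  obtain ⟨b, -, h3, h4⟩ := hy
  simp only at h1 h2 h3 h4
  rw [h1, h2, h3, h4, inG_inner, inG_inner]
  exact M.inner_T a.2 b.2

theorem isClosed_A : M.A.IsClosed := by
  have : CompleteSpace N := FiniteDimensional.complete ℂ N
  -- The graph is cut out of the closed graph of `T` by continuous conditions on both components.
  have hset : (M.A.graph : Set (WithLp 2 (G × W) × WithLp 2 (G × W))) =
      {p | (p.1.fst, p.2.fst) ∈ M.T.graph} ∩ {p | p.1.snd = 0} ∩ {p | p.2.snd = 0} ∩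
      {p | adjoint M.J p.2.fst + adjoint M.J' p.1.fst = 0} := by
    ext p
    rw [graph_A, SetLike.mem_coe, mem_minGraph]
    constructor
    · rintro ⟨x, hx, h1, h2⟩
      refine ⟨⟨⟨?_, ?_⟩, ?_⟩, ?_⟩
      · simp only [Set.mem_ofPred_eq]; rw [h1, h2]; exact x.2
      · simp [h1]
      · simp [h2]
      · simp only [Set.mem_ofPred_eq]; rw [h1, h2]; exact hx
    · rintro ⟨⟨⟨h1, h2⟩, h3⟩, h4⟩
      exact ⟨⟨_, h1⟩, h4, prod_ext rfl h2, prod_ext rfl h3⟩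
  change IsClosed (M.A.graph : Set (WithLp 2 (G × W) × WithLp 2 (G × W)))
  rw [hset]
  have c1 : Continuous fun p : WithLp 2 (G × W) × WithLp 2 (G × W) => p.1.fst :=
    (WithLp.fstL 2 ℂ G W).continuous.comp continuous_fst
  have c2 : Continuous fun p : WithLp 2 (G × W) × WithLp 2 (G × W) => p.2.fst :=
    (WithLp.fstL 2 ℂ G W).continuous.comp continuous_snd
  have c3 : Continuous fun p : WithLp 2 (G × W) × WithLp 2 (G × W) => p.1.snd :=
    (WithLp.sndL 2 ℂ G W).continuous.comp continuous_fst
  have c4 : Continuous fun p : WithLp 2 (G × W) × WithLp 2 (G × W) => p.2.snd :=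
    (WithLp.sndL 2 ℂ G W).continuous.comp continuous_snd
  exact (((M.isClosed_T_graph.preimage (c1.prodMk c2)).inter (isClosed_singleton.preimage c3)).inter
    (isClosed_singleton.preimage c4)).inter
      (isClosed_singleton.preimage (((adjoint M.J).continuous.comp c2).add
        ((adjoint M.J').continuous.comp c1)))

/-- `H₀` is all of `G`: the restriction loses no density. A vector `u ∈ G` orthogonal to `dom A`
gives `(-J n, u + J' n)` in the graph of `T` for some `n`; then `n = 0` by singularity, and `u = T 0
= 0`. -/
theorem mem_closure_domain_A {g : WithLp 2 (G × W)} :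
    g ∈ M.A.domain.topologicalClosure ↔ g.snd = 0 := by
  rw [← Submodule.orthogonal_orthogonal_eq_closure]
  constructor
  · intro h
    have h0 : inW G W g.snd ∈ M.A.domainᗮ := by
      rw [Submodule.mem_orthogonal]
      intro u hu
      obtain ⟨v, hv⟩ := LinearPMap.mem_domain_iff.1 hu
      rw [graph_A, mem_minGraph] at hv
      obtain ⟨x, -, h1, -⟩ := hv
      simp only at h1
      rw [h1, inner_inW, inG_snd, inner_zero_left]
    have := (Submodule.mem_orthogonal' _ _).1 h _ h0
    rw [inner_inW, inner_self_eq_zero] at this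
    exact this
  · intro h
    rw [Submodule.mem_orthogonal]
    intro u hu
    have hu0 : u.fst = 0 := by
      obtain ⟨n, hn⟩ := M.exists_of_bdry_eq_zero (f := 0) (g := u.fst) fun x hx => by
        have := (Submodule.mem_orthogonal _ _).1 hu (inG G W x.1.1)
          (LinearPMap.mem_domain_of_mem_graph (y := inG G W x.1.2) (by
            rw [graph_A, mem_minGraph]; exact ⟨x, hx, rfl, rfl⟩))
        rw [inG_inner] at this
        rw [this, inner_zero_right]
      rw [zero_sub, ← map_neg] at hn
      have hn0 := M.singular_of_graph hn
      rw [neg_eq_zero] at hn0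
      rw [hn0] at hn
      simpa using M.T_single (by simpa using hn)
    rw [WithLp.prod_inner_apply]
    change ⟪u.fst, g.fst⟫_ℂ + ⟪u.snd, g.snd⟫_ℂ = 0
    rw [hu0, h]; simp

theorem adjL_snd (f : HPlus M.A) : (HPlus.adjL M.A f).snd = 0 :=
  M.mem_closure_domain_A.1 (HPlus.adjL_mem M.A f)

/-- Every element of `H₊` is the sum of an element of `dom T`, a singular direction and an element
of `W`. -/
theorem exists_decomposition (f : HPlus M.A) : ∃ n : N,
    ((HPlus.incl M.A f).fst - M.J n, (HPlus.adjL M.A f).fst + M.J' n) ∈ M.T.graph := by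
  refine M.exists_of_bdry_eq_zero fun x hx => ?_
  have h : (inG G W x.1.1, inG G W x.1.2) ∈ M.A.graph := by
    rw [graph_A, mem_minGraph]; exact ⟨x, hx, rfl, rfl⟩
  have := HPlus.inner_graph f h
  rwa [inG_inner, inG_inner] at this

/-- Converse of the decomposition: the boundary condition defining `A` is exactly what puts `J n` in
`dom A*` with `A* J n = -J' n`. All of `W` lies in `ker A*`, being orthogonal to the range of `A`.
-/
theorem exists_hplus {a b : G} (hab : (a, b) ∈ M.T.graph) (n : N) (w : W) :
    ∃ f : HPlus M.A, HPlus.incl M.A f = inG G W (a + M.J n) + inW G W w ∧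
      HPlus.adjL M.A f = inG G W (b - M.J' n) := by
  refine HPlus.exists_of_inner (M.mem_closure_domain_A.2 (by simp)) fun c d hcd => ?_
  rw [graph_A, mem_minGraph] at hcd
  obtain ⟨x, hx, h1, h2⟩ := hcd
  simp only at h1 h2
  have hb := M.inner_bdry x n
  rw [hx, inner_zero_left] at hb
  have ht := M.inner_T x.2 hab
  rw [h1, h2, inner_add_right, inner_inG, inner_inW, inner_inG]
  simp only [inG_fst, inG_snd, inner_zero_left, inner_add_right, inner_sub_right]
  linear_combination ht - hb

/-- A graph element of `T` with prescribed boundary value. -/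
def lift (m : N) : M.T.graph := (M.bdry_surjective m).choose

theorem bdry_lift (m : N) : M.bdry (M.lift m) = m := (M.bdry_surjective m).choose_spec

/-- The coefficient of the singular direction of an element of `H₊`. -/
def sing : HPlus M.A →L[ℂ] N :=
  ∑ i, ((innerSL ℂ (M.lift (stdOrthonormalBasis ℂ N i)).1.2) ∘L WithLp.fstL 2 ℂ G W ∘L
      HPlus.incl M.A
    - (innerSL ℂ (M.lift (stdOrthonormalBasis ℂ N i)).1.1) ∘L WithLp.fstL 2 ℂ G W ∘L
      HPlus.adjL M.A).smulRight (stdOrthonormalBasis ℂ N i)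

/-- Green's identity: the failure of symmetry between `T` and `A*` is the pairing of the boundary
value with the singular coefficient. -/
theorem inner_graph_sub {f : HPlus M.A} {n : N}
    (h : ((HPlus.incl M.A f).fst - M.J n, (HPlus.adjL M.A f).fst + M.J' n) ∈ M.T.graph)
    (x : M.T.graph) :
    ⟪x.1.2, (HPlus.incl M.A f).fst⟫_ℂ - ⟪x.1.1, (HPlus.adjL M.A f).fst⟫_ℂ = ⟪M.bdry x, n⟫_ℂ := by
  have := M.inner_T x.2 h
  rw [inner_bdry]
  simp only [inner_sub_right, inner_add_right] at this
  linear_combination this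

/-- Green's identity tested on lifts of an orthonormal basis of `N` reads off the coordinates of
`n`. This gives uniqueness of the coefficient, and `sing` is bounded on `H₊` by its very formula. -/
theorem sing_eq {f : HPlus M.A} {n : N}
    (h : ((HPlus.incl M.A f).fst - M.J n, (HPlus.adjL M.A f).fst + M.J' n) ∈ M.T.graph) :
    M.sing f = n := by
  have hs : M.sing f = ∑ i, (⟪(M.lift (stdOrthonormalBasis ℂ N i)).1.2, (HPlus.incl M.A f).fst⟫_ℂ
      - ⟪(M.lift (stdOrthonormalBasis ℂ N i)).1.1, (HPlus.adjL M.A f).fst⟫_ℂ) •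
        stdOrthonormalBasis ℂ N i := by
    simp [sing]
  rw [hs]
  simp only [M.inner_graph_sub h, bdry_lift]
  exact (stdOrthonormalBasis ℂ N).sum_repr' n

theorem sing_spec (f : HPlus M.A) : ((HPlus.incl M.A f).fst - M.J (M.sing f),
    (HPlus.adjL M.A f).fst + M.J' (M.sing f)) ∈ M.T.graph := by
  obtain ⟨n, hn⟩ := M.exists_decomposition f
  rwa [M.sing_eq hn]

/-- The singular functionals `g ↦ (J n, A* g) + (J' n, g)`. -/
def K₀ : N →L[ℂ] HMinus M.A :=
  ((innerSL ℂ : WithLp 2 (G × W) →L⋆[ℂ] WithLp 2 (G × W) →L[ℂ] ℂ).comp (HPlus.adjL M.A)).flip ∘L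
      inG G W ∘L M.J
    + embed M.A ∘L inG G W ∘L M.J'

theorem K₀_apply (n : N) (g : HPlus M.A) : M.K₀ n g =
    ⟪(HPlus.adjL M.A g).fst, M.J n⟫_ℂ + ⟪(HPlus.incl M.A g).fst, M.J' n⟫_ℂ := by
  rw [← inner_inG (W := W), ← inner_inG (W := W)]; rfl

/-- Testing on `dom T` shows that `(J n, h - J' n)` is in the graph of `T`, so singularity forces `n
= 0`; the rest is injectivity of `H ⊂ H₋`. Equations in `H + ran K₀` may therefore be compared
componentwise. -/
theorem eq_zero_of_K₀_eq_embed {n : N} {h : WithLp 2 (G × W)} (hn : M.K₀ n = embed M.A h) :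
    n = 0 ∧ h = 0 := by
  have h1 : (M.J n, h.fst - M.J' n) ∈ M.T.graph := (M.mem_T_graph_iff _ _).2 fun a b hab => by
    obtain ⟨f, hf, hf'⟩ := M.exists_hplus hab 0 0
    have := DFunLike.congr_fun hn f
    rw [K₀_apply, embed_apply, hf, hf'] at this
    simp only [map_zero, add_zero, sub_zero, inG_fst, inG_inner] at this
    rw [inner_sub_right]
    linear_combination this
  have h2 := M.singular_of_graph h1
  refine ⟨h2, prod_ext ?_ ?_⟩
  · rw [h2] at h1
    simpa using M.T_single (by simpa using h1)
  · obtain ⟨f, hf, hf'⟩ := M.exists_hplus M.T.graph.zero_mem 0 h.snd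
    have := DFunLike.congr_fun hn f
    rw [K₀_apply, embed_apply, hf, hf'] at this
    rw [h2] at this
    simpa [inW_inner] using this.symm

/-- The self-adjoint bi-extension of the model. -/
def D : HPlus M.A →L[ℂ] HMinus M.A :=
  embed M.A ∘L (HPlus.adjL M.A + inW G W ∘L M.D₂ ∘L WithLp.sndL 2 ℂ G W ∘L HPlus.incl M.A)
    + M.K₀ ∘L M.sing

theorem D_apply (f : HPlus M.A) : M.D f = embed M.A (HPlus.adjL M.A f
    + inW G W (M.D₂ (HPlus.incl M.A f).snd)) + M.K₀ (M.sing f) := rfl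

theorem D_apply_apply (f g : HPlus M.A) : M.D f g =
    ⟪(HPlus.incl M.A g).fst, (HPlus.adjL M.A f).fst⟫_ℂ
      + ⟪(HPlus.incl M.A g).snd, M.D₂ (HPlus.incl M.A f).snd⟫_ℂ
      + (⟪(HPlus.adjL M.A g).fst, M.J (M.sing f)⟫_ℂ
      + ⟪(HPlus.incl M.A g).fst, M.J' (M.sing f)⟫_ℂ) := by
  have h : HPlus.adjL M.A f = inG G W (HPlus.adjL M.A f).fst := prod_ext rfl (M.adjL_snd f)
  rw [D_apply, add_apply, embed_apply, K₀_apply, inner_add_right, inner_inW]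
  congr 2
  conv_lhs => rw [h]
  rw [inner_inG]

/-- Symmetry of `T` on the regular parts of `f` and `g` leaves only the terms in `J` and `J'` alone,
and these cancel by `inner_J_J'`. -/
theorem D_symm (f g : HPlus M.A) : M.D f g = conj (M.D g f) := by
  have h := M.inner_T (M.sing_spec g) (M.sing_spec f)
  have h1 := M.inner_J_J' (M.sing g) (M.sing f)
  rw [D_apply_apply, D_apply_apply]
  simp only [map_add, inner_conj_symm]
  rw [M.symm_D₂]
  simp only [inner_add_left, inner_add_right, inner_sub_left, inner_sub_right] at h
  linear_combination -h + h1

/-- `𝔻f ∈ H` forces the singular coefficient to vanish, which leaves the `G`-component of `f` in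
`dom T`. The part of `𝔻` in `H` is thus `T ⊕ D₂`. -/
theorem innerGraph_D : innerGraph M.D = M.fullGraph := by
  ext p
  constructor
  · rintro ⟨f, hf, hDf⟩
    rw [D_apply, add_comm, ← eq_sub_iff_add_eq, ← map_sub] at hDf
    obtain ⟨h1, h2⟩ := M.eq_zero_of_K₀_eq_embed hDf
    have h3 := M.sing_spec f
    rw [h1] at h3
    rw [sub_eq_zero] at h2
    refine ⟨?_, ?_⟩
    · rw [h2, ← hf]
      simpa using h3
    · rw [h2, ← hf]
      simp [M.adjL_snd f]
  · rintro ⟨h1, h2⟩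
    obtain ⟨f, hf, hf'⟩ := M.exists_hplus h1 0 p.1.snd
    have hs : M.sing f = 0 := M.sing_eq (by rw [hf, hf']; simpa using h1)
    refine ⟨f, ?_, ?_⟩
    · rw [hf]; exact prod_ext (by simp) (by simp)
    · rw [D_apply, hs, map_zero, add_zero, hf, hf']
      congr 1
      exact prod_ext (by simp) (by simp [h2])

theorem isSelfAdjointBiExtension : IsSelfAdjointBiExtension M.A M.D where
  extends_op x := by
    have hx := LinearPMap.mem_graph M.A x
    rw [graph_A] at hx
    have := M.minGraph_le hx
    rw [← innerGraph_D] at this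
    exact this
  symm := M.D_symm
  selfAdjoint_part := ⟨M.full, by rw [graph_full, innerGraph_D], M.isSelfAdjoint_full, M.A_le_full⟩

/-- `A*` does not see the `W`-component, so `1 ⊕ F₂` preserves `H₊` and leaves `A* f` unchanged. For
this reason it is an orthogonal projection in the graph inner product too. -/
theorem exists_F (f : HPlus M.A) : ∃ g : HPlus M.A,
    HPlus.incl M.A g = M.P (HPlus.incl M.A f) ∧ HPlus.adjL M.A g = HPlus.adjL M.A f := by
  obtain ⟨g, hg, hg'⟩ := M.exists_hplus (M.sing_spec f) (M.sing f) (M.F₂ (HPlus.incl M.A f).snd)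
  refine ⟨g, ?_, ?_⟩
  · rw [hg]; exact prod_ext (by simp) (by simp)
  · rw [hg']; exact prod_ext (by simp) (by simp [adjL_snd])

/-- The restriction of `1 ⊕ F₂` to `H₊`. -/
def F : HPlus M.A →L[ℂ] HPlus M.A :=
  LinearMap.mkContinuous
    { toFun := fun f => (M.exists_F f).choose
      map_add' := fun f g => HPlus.incl_injective _ (by
        rw [(M.exists_F _).choose_spec.1, map_add, map_add, map_add, (M.exists_F f).choose_spec.1,
          (M.exists_F g).choose_spec.1])
      map_smul' := fun c f => HPlus.incl_injective _ (by
        rw [(M.exists_F _).choose_spec.1, RingHom.id_apply, map_smul, map_smul, map_smul,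
          (M.exists_F f).choose_spec.1]) }
    -- The bound rests on `‖P‖² ≤ (‖P‖ + 1)²` for the component in `H` and on `1 ≤ (‖P‖ + 1)²` for
    -- the value of `A*`.
    (‖M.P‖ + 1) fun f => by
      simp only [LinearMap.coe_mk, AddHom.coe_mk]
      refine le_of_sq_le_sq ?_ (by positivity)
      rw [HPlus.norm_sq_eq, (M.exists_F _).choose_spec.1, (M.exists_F _).choose_spec.2, mul_pow,
        HPlus.norm_sq_eq M.A f]
      have h1 : ‖M.P (HPlus.incl M.A f)‖ ^ 2 ≤ (‖M.P‖ * ‖HPlus.incl M.A f‖) ^ 2 :=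
        pow_le_pow_left₀ (norm_nonneg _) (M.P.le_opNorm _) 2
      have h2 := norm_nonneg M.P
      nlinarith [sq_nonneg ‖HPlus.incl M.A f‖, sq_nonneg ‖HPlus.adjL M.A f‖,
        mul_nonneg h2 (sq_nonneg ‖HPlus.incl M.A f‖), mul_nonneg h2 (sq_nonneg ‖HPlus.adjL M.A f‖),
        mul_nonneg (sq_nonneg ‖M.P‖) (sq_nonneg ‖HPlus.adjL M.A f‖)]

theorem incl_F (f : HPlus M.A) : HPlus.incl M.A (M.F f) = M.P (HPlus.incl M.A f) :=
  (M.exists_F f).choose_spec.1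

theorem adjL_F (f : HPlus M.A) : HPlus.adjL M.A (M.F f) = HPlus.adjL M.A f :=
  (M.exists_F f).choose_spec.2

theorem isOrthogonalProjectionInBoth_F : IsOrthogonalProjectionInBoth M.F := by
  refine ⟨⟨?_, fun f g => ?_⟩, M.P, ?_, M.incl_F⟩
  · refine LinearMap.ext fun f => HPlus.incl_injective _ ?_
    change HPlus.incl M.A (M.F (M.F f)) = HPlus.incl M.A (M.F f)
    rw [incl_F, incl_F, P_idem]
  · change ⟪M.F f, g⟫_ℂ = ⟪f, M.F g⟫_ℂ
    rw [HPlus.inner_eq, HPlus.inner_eq, incl_F, incl_F, adjL_F, adjL_F, P_symm]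
  · refine ⟨ContinuousLinearMap.ext fun x => M.P_idem x, ?_⟩
    rw [ContinuousLinearMap.isSelfAdjoint_iff_isSymmetric]
    exact M.P_symm

end RiggedModel

end Model

/-! ### Resolvents, the set `ρ` and the transfer function of the model. -/

section Model

open ContinuousLinearMap (adjoint)

namespace RiggedModel

variable {G N W : Type v}
  [NormedAddCommGroup G] [InnerProductSpace ℂ G] [CompleteSpace G]
  [NormedAddCommGroup N] [InnerProductSpace ℂ N]
  [NormedAddCommGroup W] [InnerProductSpace ℂ W] [CompleteSpace W]
  (M : RiggedModel G N W)

/-- `R` is the bounded inverse of `T - z`. -/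
structure IsResolvent (z : ℂ) (R : G →L[ℂ] G) : Prop where
  graph_mem : ∀ y, (R y, y + z • R y) ∈ M.T.graph
  left_inv : ∀ a b, (a, b) ∈ M.T.graph → R (b - z • a) = a

variable {M} in
theorem IsResolvent.conj {z : ℂ} {R : G →L[ℂ] G} (hR : M.IsResolvent z R) :
    M.IsResolvent (conj z) (adjoint R) where
  graph_mem y := (M.mem_T_graph_iff _ _).2 fun a b hab => by
    have h := hR.left_inv a b hab
    rw [ContinuousLinearMap.adjoint_inner_right, inner_add_right, inner_smul_right,
      ContinuousLinearMap.adjoint_inner_right]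
    rw [map_sub, map_smul, sub_eq_iff_eq_add] at h
    rw [h, inner_add_left, inner_smul_left]
  left_inv a b hab := ext_inner_right ℂ fun y => by
    have h := M.inner_T hab (hR.graph_mem y)
    rw [ContinuousLinearMap.adjoint_inner_left, inner_sub_left, h, inner_add_right,
      inner_smul_left, inner_smul_right, starRingEnd_self_apply, add_sub_cancel_right]

/-- Neumann series: `R (1 - (z - l) R)⁻¹` inverts `T - z` when `z` is close to `l`. -/
theorem isOpen_resolventSet : IsOpen {z | ∃ R, M.IsResolvent z R} := by
  rw [Metric.isOpen_iff]
  rintro l ⟨R, hR⟩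
  refine ⟨(‖R‖ + 1)⁻¹, by positivity, fun z hz => ?_⟩
  have hlt : ‖(z - l) • R‖ < 1 := by
    rw [Metric.mem_ball, dist_eq_norm] at hz
    rw [norm_smul]
    calc ‖z - l‖ * ‖R‖ ≤ ‖z - l‖ * (‖R‖ + 1) := by gcongr; linarith
      _ < (‖R‖ + 1)⁻¹ * (‖R‖ + 1) := by gcongr
      _ = 1 := inv_mul_cancel₀ (by positivity)
  let U := Units.oneSub ((z - l) • R) hlt
  have h1 : ∀ y, (U⁻¹).1 y - (z - l) • R ((U⁻¹).1 y) = y := fun y => by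
    have := DFunLike.congr_fun U.mul_inv y
    exact this
  have h2 : ∀ y, (U⁻¹).1 (y - (z - l) • R y) = y := fun y => by
    have := DFunLike.congr_fun U.inv_mul y
    exact this
  refine ⟨R ∘L (U⁻¹).1, fun y => ?_, fun a b hab => ?_⟩
  · have := hR.graph_mem ((U⁻¹).1 y)
    have h3 := h1 y
    rw [ContinuousLinearMap.comp_apply]
    convert this using 2
    generalize (U⁻¹).1 y = x at *
    rw [← h3]
    module
  · have ha := hR.left_inv a b hab
    have hb : b - z • a = (b - l • a) - (z - l) • R (b - l • a) := by
      rw [ha, sub_smul]; abel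
    rw [ContinuousLinearMap.comp_apply, hb, h2, ha]

variable [FiniteDimensional ℂ N]

theorem pencil_apply (z : ℂ) (f : HPlus M.A) : pencil M.D M.F z f =
    embed M.A (HPlus.adjL M.A f + inW G W (M.D₂ (HPlus.incl M.A f).snd)
      - z • M.P (HPlus.incl M.A f)) + M.K₀ (M.sing f) := by
  rw [map_sub, map_smul, ← incl_F, sub_add_eq_add_sub, ← D_apply]
  rfl

/-- Since `H` and `ran K₀` are independent in `H₋`, the equation decouples into a singular
coefficient, an equation in `G` and one in `W`. -/
theorem pencil_eq_iff (z : ℂ) (f : HPlus M.A) (h : WithLp 2 (G × W)) (m : N) :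
    pencil M.D M.F z f = embed M.A h + M.K₀ m ↔ M.sing f = m ∧
      (HPlus.adjL M.A f).fst - z • (HPlus.incl M.A f).fst = h.fst ∧
      M.D₂ (HPlus.incl M.A f).snd - z • M.F₂ (HPlus.incl M.A f).snd = h.snd := by
  rw [pencil_apply]
  constructor
  · intro he
    have h0 : M.K₀ (M.sing f - m) = embed M.A (h - (HPlus.adjL M.A f
        + inW G W (M.D₂ (HPlus.incl M.A f).snd) - z • M.P (HPlus.incl M.A f))) := by
      rw [map_sub, map_sub (embed M.A) h, sub_eq_sub_iff_add_eq_add, add_comm, he]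
    obtain ⟨h1, h2⟩ := M.eq_zero_of_K₀_eq_embed h0
    rw [sub_eq_zero] at h1 h2
    refine ⟨h1, ?_, ?_⟩
    · rw [h2]; simp
    · rw [h2]; simp [M.adjL_snd f]
  · rintro ⟨h1, h2, h3⟩
    rw [h1]
    congr 2
    exact prod_ext (by simp [← h2]) (by simp [← h3, M.adjL_snd f])

/-- Writing the `G`-component as `a + J m` with `a ∈ dom T`, where `A*` gives `T a - J' m`, the
equation in `G` becomes `(T - z) a = h + J' m + z J m`, which the resolvent solves. -/
theorem exists_solution {z : ℂ} {R : G →L[ℂ] G} (hR : M.IsResolvent z R) {S : W → W}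
    (hS : ∀ w, M.D₂ (S w) - z • M.F₂ (S w) = w) (h : WithLp 2 (G × W)) (m : N) :
    ∃ f : HPlus M.A, pencil M.D M.F z f = embed M.A h + M.K₀ m ∧
      HPlus.incl M.A f = inG G W (R (h.fst + M.J' m + z • M.J m) + M.J m) + inW G W (S h.snd) ∧
      HPlus.adjL M.A f = inG G W
        (h.fst + z • (R (h.fst + M.J' m + z • M.J m) + M.J m)) := by
  obtain ⟨f, hf, hf'⟩ := M.exists_hplus (hR.graph_mem (h.fst + M.J' m + z • M.J m)) m (S h.snd)
  have hf'' : HPlus.adjL M.A f = inG G W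
        (h.fst + z • (R (h.fst + M.J' m + z • M.J m) + M.J m)) := by
    rw [hf']
    congr 1
    rw [smul_add]
    abel
  refine ⟨f, ?_, hf, hf''⟩
  rw [pencil_eq_iff]
  refine ⟨M.sing_eq ?_, ?_, ?_⟩
  · rw [hf, hf']
    simpa using hR.graph_mem (h.fst + M.J' m + z • M.J m)
  · rw [hf, hf'']; simp
  · rw [hf]; simpa using hS h.snd

theorem pencil_symm (z : ℂ) (f g : HPlus M.A) :
    pencil M.D M.F z f g = conj (pencil M.D M.F (conj z) g f) := by
  have h : ∀ (z : ℂ) (f g : HPlus M.A), pencil M.D M.F z f g =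
      M.D f g - z * ⟪HPlus.incl M.A g, M.P (HPlus.incl M.A f)⟫_ℂ := fun z f g => by
    rw [← incl_F]; rfl
  rw [h, h, map_sub, ← D_symm, map_mul, starRingEnd_self_apply, inner_conj_symm, P_symm]

/-- Duality: continuity from `H₋` to `H` at `z` follows from continuity from `H` to `H₊` at `conj
z`. Solving the conjugate problem with right side `y = f ∈ H` yields `g` with `‖g‖₊ ≤ C‖y‖`, and
`‖y‖²` equals the pairing of `(𝔻 - zF₊)f` with `g`. -/
theorem norm_incl_le {z : ℂ} {R : G →L[ℂ] G} (hR : M.IsResolvent z R)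
    (hinv : ∀ z : ℂ, ∃ S : W →L[ℂ] W, ∀ w, M.D₂ (S w) - z • M.F₂ (S w) = w) :
    ∃ C : ℝ, ∀ f : HPlus M.A, ‖HPlus.incl M.A f‖ ≤ C * ‖pencil M.D M.F z f‖ := by
  obtain ⟨S, hS⟩ := hinv (conj z)
  let R' := adjoint R
  have hR' : M.IsResolvent (conj z) R' := hR.conj
  let X : WithLp 2 (G × W) →L[ℂ] WithLp 2 (G × W) :=
    inG G W ∘L R' ∘L WithLp.fstL 2 ℂ G W + inW G W ∘L S ∘L WithLp.sndL 2 ℂ G W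
  let Y : WithLp 2 (G × W) →L[ℂ] WithLp 2 (G × W) :=
    inG G W ∘L (WithLp.fstL 2 ℂ G W + conj z • R' ∘L WithLp.fstL 2 ℂ G W)
  refine ⟨‖X‖ + ‖Y‖, fun f => ?_⟩
  set y := HPlus.incl M.A f with hy
  obtain ⟨g, hg, hg1, hg2⟩ := M.exists_solution hR' hS y 0
  simp only [map_zero, add_zero, smul_zero] at hg hg1 hg2
  have hgX : HPlus.incl M.A g = X y := hg1
  have hgY : HPlus.adjL M.A g = Y y := hg2
  have hnorm : ‖g‖ ≤ (‖X‖ + ‖Y‖) * ‖y‖ := by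
    refine le_of_sq_le_sq ?_ (by positivity)
    rw [HPlus.norm_sq_eq, hgX, hgY]
    have h1 := pow_le_pow_left₀ (norm_nonneg _) (X.le_opNorm y) 2
    have h2 := pow_le_pow_left₀ (norm_nonneg _) (Y.le_opNorm y) 2
    have h3 : 0 ≤ ‖X‖ * ‖y‖ := by positivity
    have h4 : 0 ≤ ‖Y‖ * ‖y‖ := by positivity
    nlinarith [mul_nonneg h3 h4]
  have hpair : pencil M.D M.F z f g = ⟪y, y⟫_ℂ := by
    rw [pencil_symm, hg, embed_apply, inner_conj_symm]
  have hle : ‖y‖ ^ 2 ≤ ‖pencil M.D M.F z f‖ * ((‖X‖ + ‖Y‖) * ‖y‖) := by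
    calc ‖y‖ ^ 2 = ‖pencil M.D M.F z f g‖ := by
          rw [hpair, inner_self_eq_norm_sq_to_K]
          simp
      _ ≤ ‖pencil M.D M.F z f‖ * ‖g‖ := (pencil M.D M.F z f).le_opNorm g
      _ ≤ _ := by gcongr
  rcases (norm_nonneg y).eq_or_lt with h0 | h0
  · rw [← h0]; positivity
  · have : ‖y‖ * ‖y‖ ≤ ((‖X‖ + ‖Y‖) * ‖pencil M.D M.F z f‖) * ‖y‖ := by nlinarith
    exact le_of_mul_le_mul_right this h0

section System

variable {E : Type u} [NormedAddCommGroup E] [InnerProductSpace ℂ E]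
  (B : E →L[ℂ] G) (K₂ : E →L[ℂ] W) (p : E →L[ℂ] N)

/-- The input operator of the model. -/
def K : E →L[ℂ] HMinus M.A :=
  embed M.A ∘L (inG G W ∘L B + inW G W ∘L K₂) + M.K₀ ∘L p

theorem K_apply (e : E) : M.K B K₂ p e =
    embed M.A (inG G W (B e) + inW G W (K₂ e)) + M.K₀ (p e) := rfl

theorem K_injective (hK₂ : Function.Injective K₂) : Function.Injective (M.K B K₂ p) := by
  rw [injective_iff_map_eq_zero]
  intro e he
  rw [K_apply, add_comm, add_eq_zero_iff_eq_neg, ← map_neg] at he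
  have h := (M.eq_zero_of_K₀_eq_embed he).2
  have h' := congrArg WithLp.snd h
  exact (injective_iff_map_eq_zero K₂).1 hK₂ e (by simpa using h')

/-- The `W`-pencil is solvable for every `z`, so only `T` matters. From `ρ`, a bounded resolvent
arises by solving with right sides in `G`, as `H ⊂ H₋` is contractive; conversely the estimate of
`norm_incl_le` gives both injectivity and continuity. -/
theorem mem_rho_iff (hinv : ∀ z : ℂ, ∃ S : W →L[ℂ] W, ∀ w, M.D₂ (S w) - z • M.F₂ (S w) = w)
    (z : ℂ) : z ∈ rho M.D M.F (M.K B K₂ p) ↔ ∃ R, M.IsResolvent z R := by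
  constructor
  · rintro ⟨hinj, hsurj, -, C, hC⟩
    have huniq : ∀ a, (a, z • a) ∈ M.T.graph → a = 0 := fun a ha => by
      obtain ⟨f, hf, hf'⟩ := M.exists_hplus ha 0 0
      have h0 : pencil M.D M.F z f = embed M.A 0 + M.K₀ 0 := by
        rw [pencil_eq_iff]
        refine ⟨M.sing_eq ?_, ?_, ?_⟩
        · rw [hf, hf']; simpa using ha
        · rw [hf, hf']; simp
        · rw [hf]; simp
      have hf0 : f = 0 := hinj (by simpa using h0)
      have := congrArg WithLp.fst hf
      rw [hf0] at this
      simpa using this.symm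
    have hex : ∀ y, ∃ a, (a, y + z • a) ∈ M.T.graph ∧ ‖a‖ ≤ |C| * ‖y‖ := fun y => by
      obtain ⟨f, hf⟩ := hsurj (inG G W y)
      have hb := hC f (inG G W y) 0 (by simpa using hf)
      have hf2 := (M.pencil_eq_iff z f (inG G W y) 0).1 (by simpa using hf)
      have hs := M.sing_spec f
      rw [hf2.1] at hs
      have h1 := hf2.2.1
      rw [inG_fst, sub_eq_iff_eq_add] at h1
      refine ⟨(HPlus.incl M.A f).fst, by simpa [h1] using hs, ?_⟩
      rw [map_zero, add_zero] at hb
      have hn : ‖inG G W y‖ = ‖y‖ := by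
        have : ‖inG G W y‖ ^ 2 = ‖y‖ ^ 2 := by
          rw [← inner_self_eq_norm_sq (𝕜 := ℂ), ← inner_self_eq_norm_sq (𝕜 := ℂ), inG_inner,
            inG_fst]
        exact (sq_eq_sq₀ (norm_nonneg _) (norm_nonneg _)).1 this
      have h3 : ‖(HPlus.incl M.A f).fst‖ ≤ ‖HPlus.incl M.A f‖ := by
        refine le_of_sq_le_sq ?_ (norm_nonneg _)
        rw [WithLp.prod_norm_sq_eq_of_L2]
        nlinarith [sq_nonneg ‖(HPlus.incl M.A f).snd‖]
      calc _ ≤ ‖HPlus.incl M.A f‖ := h3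
        _ ≤ C * ‖embed M.A (inG G W y)‖ := hb
        _ ≤ |C| * ‖embed M.A (inG G W y)‖ := by gcongr; exact le_abs_self C
        _ ≤ |C| * ‖y‖ := by gcongr; exact (norm_embed_le _ _).trans hn.le
    choose r hr hrn using hex
    have hr' : ∀ a y, (a, y + z • a) ∈ M.T.graph → a = r y := fun a y hay => by
      rw [← sub_eq_zero]
      refine huniq _ ?_
      have := M.T.graph.sub_mem hay (hr y)
      simpa [smul_sub] using this
    let R : G →ₗ[ℂ] G :=
      { toFun := r
        map_add' := fun x y => (hr' _ _ (by
          have := M.T.graph.add_mem (hr x) (hr y)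
          convert this using 1
          ext1
          · rfl
          · simp only [Prod.snd_add, smul_add]; abel)).symm
        map_smul' := fun c x => (hr' _ _ (by
          have := M.T.graph.smul_mem c (hr x)
          convert this using 1
          ext1
          · rfl
          · simp only [Prod.smul_snd, smul_add, RingHom.id_apply, smul_comm c z])).symm }
    refine ⟨R.mkContinuous |C| hrn, hr, fun a b hab => ?_⟩
    exact (hr' a _ (by simpa using hab)).symm
  · rintro ⟨R, hR⟩
    obtain ⟨C, hC⟩ := M.norm_incl_le hR hinv
    obtain ⟨S, hS⟩ := hinv z
    refine ⟨?_, fun h => ?_, fun e => ?_, C, fun f h e hf => ?_⟩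
    · rw [injective_iff_map_eq_zero]
      intro f hf
      have h0 : ‖pencil M.D M.F z f‖ = 0 := by
        rw [hf]; exact ContinuousLinearMap.opNorm_zero
      have := hC f
      rw [h0, mul_zero, norm_le_zero_iff] at this
      exact HPlus.incl_injective _ (by rw [this, map_zero])
    · obtain ⟨f, hf, -⟩ := M.exists_solution hR hS h 0
      exact ⟨f, by simpa using hf⟩
    · obtain ⟨f, hf, -⟩ := M.exists_solution hR hS (inG G W (B e) + inW G W (K₂ e)) (p e)
      exact ⟨f, hf⟩
    · rw [← hf]; exact hC f

theorem isDeltaPlusSystem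
    (hinv : ∀ z : ℂ, ∃ S : W →L[ℂ] W, ∀ w, M.D₂ (S w) - z • M.F₂ (S w) = w)
    (hK₂ : Function.Injective K₂) : IsDeltaPlusSystem M.A M.D M.F (M.K B K₂ p) where
  closed_op := M.isClosed_A
  hermitian_op := M.isFormalAdjoint_A
  biExtension := M.isSelfAdjointBiExtension
  injective_K := M.K_injective B K₂ p hK₂
  projection := M.isOrthogonalProjectionInBoth_F
  isOpen_rho := by
    have : rho M.D M.F (M.K B K₂ p) = {z | ∃ R, M.IsResolvent z R} :=
      Set.ext fun z => M.mem_rho_iff B K₂ p hinv z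
    rw [this]
    exact M.isOpen_resolventSet

theorem inner_dualAdjoint [FiniteDimensional ℂ E] {H : Type v} [NormedAddCommGroup H]
    [InnerProductSpace ℂ H] [CompleteSpace H] {A : H →ₗ.[ℂ] H} (K : E →L[ℂ] HMinus A)
    (f : HPlus A) (e : E) : ⟪dualAdjoint K f, e⟫_ℂ = K e f := by
  have : CompleteSpace E := FiniteDimensional.complete ℂ E
  exact InnerProductSpace.toDual_symm_apply

/-- The transfer function of the model. -/
theorem inner_transfer [FiniteDimensional ℂ E]
    (hinv : ∀ z : ℂ, ∃ S : W →L[ℂ] W, ∀ w, M.D₂ (S w) - z • M.F₂ (S w) = w)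
    {z : ℂ} {R : G →L[ℂ] G} (hR : M.IsResolvent z R) {e : E} {w : W}
    (hw : M.D₂ w - z • M.F₂ w = K₂ e) {a b : G} (hab : (a, b) ∈ M.T.graph)
    (hz : b - z • a = B e + M.J' (p e) + z • M.J (p e)) (e' : E) :
    ⟪transfer M.D M.F (M.K B K₂ p) z e, e'⟫_ℂ =
      ⟪a + M.J (p e), B e'⟫_ℂ + ⟪b, M.J (p e')⟫_ℂ + ⟪a, M.J' (p e')⟫_ℂ + ⟪w, K₂ e'⟫_ℂ := by
  have hrho := (M.mem_rho_iff B K₂ p hinv z).2 ⟨R, hR⟩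
  obtain ⟨f, hf, hf'⟩ := M.exists_hplus hab (p e) w
  have hfe : pencil M.D M.F z f = M.K B K₂ p e := by
    rw [K_apply, pencil_eq_iff]
    refine ⟨M.sing_eq ?_, ?_, ?_⟩
    · rw [hf, hf']; simpa using hab
    · rw [hf, hf']
      simp only [inG_fst, WithLp.add_fst, inW_fst, add_zero, smul_add]
      rw [sub_eq_iff_eq_add] at hz
      rw [hz]; abel
    · rw [hf]; simpa using hw
  have hinvf : Function.invFun (pencil M.D M.F z) (M.K B K₂ p e) = f :=
    hrho.1 ((Function.invFun_eq ⟨f, hfe⟩).trans hfe.symm)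
  have h1 := M.inner_J_J' (p e) (p e')
  rw [transfer, hinvf, inner_dualAdjoint, K_apply, add_apply, embed_apply,
    K₀_apply, hf, hf']
  simp only [inner_add_right, inner_inG, inner_inW, WithLp.add_fst, inG_fst, inG_snd,
    inW_fst, inW_snd, add_zero, zero_add, inner_zero_left, inner_add_left, inner_sub_left]
  linear_combination h1

end System

end RiggedModel

end Model

/-! ### A bounded pencil on `E⁴` realizing `Q + zC²`. -/

section LinearPencil

variable {E : Type u} [NormedAddCommGroup E] [InnerProductSpace ℂ E]

/-- The `i`-th coordinate on `E⁴`. -/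
abbrev coord (i : Fin 4) : PiLp 2 (fun _ : Fin 4 => E) →L[ℂ] E :=
  PiLp.proj 2 (fun _ : Fin 4 => E) i

/-- The operator into `E⁴` with the given coordinates. -/
def ofCoords {X : Type*} [NormedAddCommGroup X] [NormedSpace ℂ X] (g : Fin 4 → X →L[ℂ] E) :
    X →L[ℂ] PiLp 2 (fun _ : Fin 4 => E) :=
  (PiLp.continuousLinearEquiv 2 ℂ (fun _ : Fin 4 => E)).symm.toContinuousLinearMap ∘L
    ContinuousLinearMap.pi g

@[simp] theorem ofCoords_apply {X : Type*} [NormedAddCommGroup X] [NormedSpace ℂ X]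
    (g : Fin 4 → X →L[ℂ] E) (x : X) (i : Fin 4) : ofCoords g x i = g i x := rfl

theorem inner_pi_four (x y : PiLp 2 (fun _ : Fin 4 => E)) :
    ⟪x, y⟫_ℂ = ⟪x 0, y 0⟫_ℂ + ⟪x 1, y 1⟫_ℂ + ⟪x 2, y 2⟫_ℂ + ⟪x 3, y 3⟫_ℂ := by
  rw [PiLp.inner_apply, Fin.sum_univ_four]

/-- The main operator of a pencil on `E⁴` with transfer function `Q + zC²`. -/
def linD (Q C : E →L[ℂ] E) : PiLp 2 (fun _ : Fin 4 => E) →L[ℂ] PiLp 2 (fun _ : Fin 4 => E) :=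
  ofCoords ![coord 1, coord 0 - Q ∘L coord 1 - C ∘L coord 2, coord 3 - C ∘L coord 1, coord 2]

/-- The projection of `E⁴` onto its last coordinate. -/
def linF : PiLp 2 (fun _ : Fin 4 => E) →L[ℂ] PiLp 2 (fun _ : Fin 4 => E) :=
  ofCoords ![0, 0, 0, coord 3]

/-- The inclusion of `E` as the first coordinate of `E⁴`. -/
def linK : E →L[ℂ] PiLp 2 (fun _ : Fin 4 => E) :=
  ofCoords ![ContinuousLinearMap.id ℂ E, 0, 0, 0]

/-- The inverse of the pencil `linD Q C - z linF`. -/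
def linInv (Q C : E →L[ℂ] E) (z : ℂ) :
    PiLp 2 (fun _ : Fin 4 => E) →L[ℂ] PiLp 2 (fun _ : Fin 4 => E) :=
  ofCoords ![coord 1 + Q ∘L coord 0 + C ∘L (coord 3 + z • (coord 2 + C ∘L coord 0)), coord 0,
    coord 3 + z • (coord 2 + C ∘L coord 0), coord 2 + C ∘L coord 0]

theorem linD_symm {Q C : E →L[ℂ] E} (hQ : Q.IsSymmetric) (hC : C.IsSymmetric)
    (x y : PiLp 2 (fun _ : Fin 4 => E)) : ⟪linD Q C x, y⟫_ℂ = ⟪x, linD Q C y⟫_ℂ := by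
  have h1 : ⟪Q (x 1), y 1⟫_ℂ = ⟪x 1, Q (y 1)⟫_ℂ := hQ _ _
  have h2 : ⟪C (x 1), y 2⟫_ℂ = ⟪x 1, C (y 2)⟫_ℂ := hC _ _
  have h3 : ⟪C (x 2), y 1⟫_ℂ = ⟪x 2, C (y 1)⟫_ℂ := hC _ _
  rw [inner_pi_four, inner_pi_four]
  simp only [linD, ofCoords_apply, Matrix.cons_val, sub_apply, ContinuousLinearMap.comp_apply,
    PiLp.proj_apply, inner_sub_left, inner_sub_right]
  linear_combination -h1 - h2 - h3

theorem isStarProjection_linF [CompleteSpace E] :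
    IsStarProjection (linF : PiLp 2 (fun _ : Fin 4 => E) →L[ℂ] _) := by
  refine ⟨?_, ?_⟩
  · refine ContinuousLinearMap.ext fun x => ?_
    ext i
    fin_cases i <;> simp [linF]
  · rw [ContinuousLinearMap.isSelfAdjoint_iff_isSymmetric]
    intro x y
    change ⟪linF x, y⟫_ℂ = ⟪x, linF y⟫_ℂ
    rw [inner_pi_four, inner_pi_four]
    simp [linF]

theorem linD_linInv (Q C : E →L[ℂ] E) (z : ℂ) (x : PiLp 2 (fun _ : Fin 4 => E)) :
    linD Q C (linInv Q C z x) - z • linF (linInv Q C z x) = x := by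
  ext i
  fin_cases i <;> simp [linD, linF, linInv]
  abel

theorem linK_injective : Function.Injective (linK : E →L[ℂ] _) := fun x y h => by
  have := congrFun (congrArg WithLp.ofLp h) 0
  simpa [linK] using this

/-- With right side `(e, 0, 0, 0)` the coordinates are forced in turn: `x₁ = e`, `x₃ = Ce`, `x₂ =
zCe`, and finally `x₀ = Qe + zC²e`, which is the output. -/
theorem inner_linInv_linK (Q C : E →L[ℂ] E) (z : ℂ) (e e' : E) :
    ⟪linInv Q C z (linK e), linK e'⟫_ℂ = ⟪Q e + z • C (C e), e'⟫_ℂ := by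
  rw [inner_pi_four]
  simp [linInv, linK]

end LinearPencil

/-! ### The operator measure as a squared density with respect to its trace. -/

section Density

open Filter Topology

variable {E : Type u} [NormedAddCommGroup E] [InnerProductSpace ℂ E]

/-- The polarization `¼ ∑ₖ iᵏ F(x + iᵏy)`. -/
def polar (F : E → ℝ) (x y : E) : ℂ :=
  (1 / 4 : ℂ) * ∑ k : Fin 4, Complex.I ^ (k : ℕ) * (F (x + Complex.I ^ (k : ℕ) • y) : ℂ)

/-- `F` is the real part of the quadratic form of an operator. -/
def IsForm (F : E → ℝ) : Prop := ∃ A : E →L[ℂ] E, ∀ x, F x = (⟪x, A x⟫_ℂ).re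

theorem IsForm.sub {F F' : E → ℝ} (h : IsForm F) (h' : IsForm F') :
    IsForm fun x => F x - F' x := by
  obtain ⟨A, hA⟩ := h
  obtain ⟨A', hA'⟩ := h'
  exact ⟨A - A', fun x => by simp [hA, hA']⟩

theorem IsForm.mul_const {F : E → ℝ} (h : IsForm F) (c : ℝ) : IsForm fun x => F x * c := by
  obtain ⟨A, hA⟩ := h
  exact ⟨(c : ℂ) • A, fun x => by simp [hA, mul_comm]⟩

theorem polar_re_inner [CompleteSpace E] (A : E →L[ℂ] E) (x y : E) :
    polar (fun x => (⟪x, A x⟫_ℂ).re) x y =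
      ⟪y, ((1 / 2 : ℂ) • (A + ContinuousLinearMap.adjoint A)) x⟫_ℂ := by
  have hre : ∀ x, (((⟪x, A x⟫_ℂ).re : ℝ) : ℂ) = (1 / 2 : ℂ) * (⟪x, A x⟫_ℂ + ⟪A x, x⟫_ℂ) := by
    intro x
    rw [Complex.re_eq_add_conj, inner_conj_symm]; ring
  have hI2 : Complex.I ^ 2 = -1 := Complex.I_sq
  have hI3 : Complex.I ^ 3 = -Complex.I := by rw [pow_succ, hI2]; ring
  simp only [polar, hre]
  simp only [Fin.sum_univ_four, smul_apply, add_apply, inner_smul_right, inner_add_right,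
    inner_add_left, inner_smul_left, map_add, map_smul, ContinuousLinearMap.adjoint_inner_right]
  simp only [Fin.isValue, pow_zero, pow_one, hI2, hI3, map_one, map_neg, Complex.conj_I, Fin.coe_ofNat_eq_mod, Nat.reduceMod]
  ring_nf
  simp only [hI2]
  ring

variable {S : ℝ → E →L[ℂ] E} (hS : IsNondecreasing S)

/-- The parallelogram law holds for the forms at each point and survives right limits, hence holds
for the distribution functions of the measures. No right continuity of `S` is needed. -/
theorem quadMeasure_parallelogram (x y : E) :
    quadMeasure hS (x + y) + quadMeasure hS (x - y) =
      (quadMeasure hS x + quadMeasure hS x) + (quadMeasure hS y + quadMeasure hS y) := by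
  simp only [quadMeasure, ← StieltjesFunction.measure_add]
  congr 1
  ext t
  simp only [StieltjesFunction.add_apply, Monotone.stieltjesFunction_eq]
  refine tendsto_nhds_unique (((hS.monotone_form (x + y)).tendsto_rightLim t).add
    ((hS.monotone_form (x - y)).tendsto_rightLim t)) ?_
  refine ((((hS.monotone_form x).tendsto_rightLim t).add
    ((hS.monotone_form x).tendsto_rightLim t)).add (((hS.monotone_form y).tendsto_rightLim t).add
    ((hS.monotone_form y).tendsto_rightLim t))).congr fun s => ?_
  simp only [map_add, map_sub, inner_add_left, inner_add_right, inner_sub_left, inner_sub_right,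
    Complex.add_re, Complex.sub_re]
  ring

theorem quadMeasure_smul (c : ℂ) (x : E) :
    quadMeasure hS (c • x) = (‖c‖₊ ^ 2) • quadMeasure hS x := by
  simp only [quadMeasure, ← StieltjesFunction.measure_smul]
  congr 1
  ext t
  change Function.rightLim _ t = ((‖c‖₊ ^ 2 : NNReal) : ℝ) * Function.rightLim _ t
  refine tendsto_nhds_unique ((hS.monotone_form (c • x)).tendsto_rightLim t) ?_
  refine (((hS.monotone_form x).tendsto_rightLim t).const_mul _).congr fun s => ?_
  rw [map_smul, inner_smul_left, inner_smul_right, ← mul_assoc, Complex.conj_mul']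
  push_cast
  rw [← Complex.ofReal_pow, Complex.re_ofReal_mul]

variable [FiniteDimensional ℂ E]

/-- The operator with the given matrix entries in the standard orthonormal basis. -/
def opOf (s : E → E → ℂ) : E →L[ℂ] E :=
  ∑ i, ∑ j, s (stdOrthonormalBasis ℂ E j) (stdOrthonormalBasis ℂ E i) •
    InnerProductSpace.rankOne ℂ (stdOrthonormalBasis ℂ E i) (stdOrthonormalBasis ℂ E j)

theorem opOf_eq {s : E → E → ℂ} {A : E →L[ℂ] E} (h : ∀ x y, s x y = ⟪y, A x⟫_ℂ) : opOf s = A := by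
  ext x
  simp only [opOf, h, sum_apply, smul_apply,
    InnerProductSpace.rankOne_apply]
  have h1 : ∀ i, ⟪stdOrthonormalBasis ℂ E i, A x⟫_ℂ = ∑ j, ⟪stdOrthonormalBasis ℂ E j, x⟫_ℂ *
      ⟪stdOrthonormalBasis ℂ E i, A (stdOrthonormalBasis ℂ E j)⟫_ℂ := fun i => by
    conv_lhs => rw [← (stdOrthonormalBasis ℂ E).sum_repr' x]
    simp only [map_sum, map_smul, inner_sum, inner_smul_right]
  conv_rhs => rw [← (stdOrthonormalBasis ℂ E).sum_repr' (A x)]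
  refine Finset.sum_congr rfl fun i _ => ?_
  rw [h1, Finset.sum_smul]
  refine Finset.sum_congr rfl fun j _ => ?_
  rw [smul_smul, mul_comm]

/-- The operator reconstructed from a quadratic form by polarization. -/
def formOp (F : E → ℝ) : E →L[ℂ] E := opOf (polar F)

theorem formOp_re_inner [CompleteSpace E] {F : E → ℝ} {A : E →L[ℂ] E}
    (h : ∀ x, F x = (⟪x, A x⟫_ℂ).re) :
    formOp F = (1 / 2 : ℂ) • (A + ContinuousLinearMap.adjoint A) := by
  have : F = fun x => (⟪x, A x⟫_ℂ).re := funext h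
  rw [this]
  exact opOf_eq (polar_re_inner A)

theorem IsForm.eq_formOp {F : E → ℝ} (h : IsForm F) (x : E) : F x = (⟪x, formOp F x⟫_ℂ).re := by
  have : CompleteSpace E := FiniteDimensional.complete ℂ E
  obtain ⟨A, hA⟩ := h
  rw [formOp_re_inner hA, hA]
  simp only [smul_apply, add_apply, inner_smul_right, inner_add_right,
    ContinuousLinearMap.adjoint_inner_right]
  rw [← inner_conj_symm (A x) x, Complex.add_conj]
  simp

theorem IsForm.isPositive_formOp {F : E → ℝ} (h : IsForm F) (hF : ∀ x, 0 ≤ F x) :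
    (formOp F).IsPositive := by
  have : CompleteSpace E := FiniteDimensional.complete ℂ E
  rw [ContinuousLinearMap.isPositive_def']
  refine ⟨?_, fun x => ?_⟩
  · obtain ⟨A, hA⟩ := h
    rw [formOp_re_inner hA, IsSelfAdjoint, star_smul, star_add,
      ContinuousLinearMap.star_eq_adjoint, ContinuousLinearMap.star_eq_adjoint,
      ContinuousLinearMap.adjoint_adjoint, add_comm A]
    simp
  · rw [ContinuousLinearMap.reApplyInnerSelf_apply]
    have := hF x
    rw [h.eq_formOp, ← inner_conj_symm, Complex.conj_re] at this
    simpa using this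

theorem tendsto_formOp {ι : Type*} {l : Filter ι} {F : ι → E → ℝ} {F' : E → ℝ}
    (h : ∀ i j (k : Fin 4), Tendsto
      (fun r => F r (stdOrthonormalBasis ℂ E j + Complex.I ^ (k : ℕ) • stdOrthonormalBasis ℂ E i)) l
      (𝓝 (F' (stdOrthonormalBasis ℂ E j + Complex.I ^ (k : ℕ) • stdOrthonormalBasis ℂ E i)))) :
    Tendsto (fun r => formOp (F r)) l (𝓝 (formOp F')) := by
  unfold formOp opOf polar
  refine tendsto_finsetSum _ fun i _ => tendsto_finsetSum _ fun j _ => ?_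
  refine Tendsto.smul_const (Tendsto.const_mul _ (tendsto_finsetSum _ fun k _ => ?_)) _
  exact Tendsto.const_mul _ ((Complex.continuous_ofReal.tendsto _).comp (h i j k))

/-- In finite dimension pointwise convergence of forms on finitely many polarization vectors already
makes the reconstructed operators converge. So one-sided limits of `S` remain forms. -/
theorem IsForm.of_tendsto {ι : Type*} {l : Filter ι} [l.NeBot] {F : ι → E → ℝ} {F' : E → ℝ}
    (hF : ∀ r, IsForm (F r)) (h : ∀ x, Tendsto (fun r => F r x) l (𝓝 (F' x))) : IsForm F' := by
  refine ⟨formOp F', fun x => tendsto_nhds_unique (h x) ?_⟩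
  have h1 : Tendsto (fun r => (⟪x, formOp (F r) x⟫_ℂ).re) l (𝓝 (⟪x, formOp F' x⟫_ℂ).re) := by
    have h2 := tendsto_formOp (F := F) (F' := F') (l := l) fun i j k => h _
    have hc : Continuous fun A : E →L[ℂ] E => (⟪x, A x⟫_ℂ).re := by fun_prop
    exact (hc.tendsto _).comp h2
  exact h1.congr fun r => ((hF r).eq_formOp x).symm

theorem isForm_quadMeasure_Icc {a b : ℝ} (hab : a ≤ b) :
    IsForm fun x => (quadMeasure hS x (Set.Icc a b)).toReal := by
  have h1 : ∀ t, IsForm fun x => (hS.monotone_form x).stieltjesFunction t := fun t =>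
    IsForm.of_tendsto (l := 𝓝[>] t) (F := fun s x => (⟪x, S s x⟫_ℂ).re)
      (fun s => ⟨S s, fun x => rfl⟩) fun x => (hS.monotone_form x).tendsto_rightLim t
  have h2 : IsForm fun x => Function.leftLim (hS.monotone_form x).stieltjesFunction a :=
    IsForm.of_tendsto (l := 𝓝[<] a) h1
      fun x => ((hS.monotone_form x).stieltjesFunction.mono).tendsto_leftLim a
  convert (h1 b).sub h2 using 2 with x
  rw [quadMeasure, StieltjesFunction.measure_Icc, ENNReal.toReal_ofReal]
  exact sub_nonneg.2 ((hS.monotone_form x).stieltjesFunction.mono.leftLim_le hab)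

/-- The trace measure of a nondecreasing operator function. -/
def traceMeasure : Measure ℝ := ∑ i, quadMeasure hS (stdOrthonormalBasis ℂ E i)

instance quadMeasure.isLocallyFiniteMeasure (x : E) : IsLocallyFiniteMeasure (quadMeasure hS x) :=
  inferInstanceAs (IsLocallyFiniteMeasure (hS.monotone_form x).stieltjesFunction.measure)

instance traceMeasure.isLocallyFiniteMeasure : IsLocallyFiniteMeasure (traceMeasure hS) := by
  refine ⟨fun t => ?_⟩
  refine ⟨Set.Icc (t - 1) (t + 1), Icc_mem_nhds (by linarith) (by linarith), ?_⟩
  rw [traceMeasure, Measure.finsetSum_apply]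
  exact ENNReal.sum_lt_top.2 fun i _ => isCompact_Icc.measure_lt_top

/-- By the parallelogram law and homogeneity, the vectors whose measure is dominated by the trace
form a subspace, and it contains the basis. -/
theorem quadMeasure_absolutelyContinuous (x : E) : quadMeasure hS x ≪ traceMeasure hS := by
  let N : Submodule ℂ E :=
    { carrier := {x | quadMeasure hS x ≪ traceMeasure hS}
      zero_mem' := by
        have := quadMeasure_smul hS 0 (0 : E)
        simp only [smul_zero, nnnorm_zero, ne_eq, OfNat.ofNat_ne_zero, not_false_eq_true, zero_pow,
          zero_smul] at this
        rw [Set.mem_ofPred_eq, this]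
        exact Measure.AbsolutelyContinuous.zero _
      add_mem' := fun {x y} hx hy s hs => by
        have h := congrArg (fun m => m s) (quadMeasure_parallelogram hS x y)
        simp only [Measure.add_apply, hx hs, hy hs, add_zero] at h
        exact (add_eq_zero.1 h).1
      smul_mem' := fun c x hx s hs => by
        rw [quadMeasure_smul, Measure.smul_apply, hx hs, smul_zero] }
  have hb : ∀ i, stdOrthonormalBasis ℂ E i ∈ N := fun i s hs => by
    rw [traceMeasure, Measure.finsetSum_apply, Finset.sum_eq_zero_iff] at hs
    exact hs i (Finset.mem_univ i)
  have : x ∈ N := by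
    rw [← (stdOrthonormalBasis ℂ E).sum_repr' x]
    exact Submodule.sum_mem _ fun i _ => N.smul_mem _ (hb i)
  exact this

/-- The density of the operator measure with respect to its trace. -/
def opDensity (t : ℝ) : E →L[ℂ] E :=
  formOp fun y => ((quadMeasure hS y).rnDeriv (traceMeasure hS) t).toReal

theorem stronglyMeasurable_opDensity : StronglyMeasurable (opDensity hS) := by
  unfold opDensity formOp opOf polar
  refine Finset.stronglyMeasurable_fun_sum _ fun i _ =>
    Finset.stronglyMeasurable_fun_sum _ fun j _ => StronglyMeasurable.smul_const ?_ _
  refine Measurable.stronglyMeasurable ?_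
  have := fun y => Measure.measurable_rnDeriv (quadMeasure hS y) (traceMeasure hS)
  fun_prop

/-- The ratio of the operator measure of a ball by its trace. -/
def ballRatio (t r : ℝ) (x : E) : ℝ :=
  (quadMeasure hS x (Metric.closedBall t r) / traceMeasure hS (Metric.closedBall t r)).toReal

theorem isForm_ballRatio (t : ℝ) {r : ℝ} (hr : 0 ≤ r) : IsForm (ballRatio hS t r) := by
  have h := (isForm_quadMeasure_Icc hS (show t - r ≤ t + r by linarith)).mul_const
    (traceMeasure hS (Metric.closedBall t r)).toReal⁻¹
  convert h using 2 with x
  rw [ballRatio, ENNReal.toReal_div, div_eq_mul_inv, Real.closedBall_eq_Icc]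

theorem ae_tendsto_ballRatio (x : E) : ∀ᵐ t ∂(traceMeasure hS),
    Tendsto (fun r => ballRatio hS t r x) (𝓝[>] 0)
      (𝓝 ((quadMeasure hS x).rnDeriv (traceMeasure hS) t).toReal) := by
  filter_upwards [Besicovitch.ae_tendsto_rnDeriv (quadMeasure hS x) (traceMeasure hS),
    Measure.rnDeriv_lt_top (quadMeasure hS x) (traceMeasure hS)] with t h1 h2
  exact (ENNReal.tendsto_toReal h2.ne).comp h1

theorem ae_tendsto_formOp_ballRatio : ∀ᵐ t ∂(traceMeasure hS),
    Tendsto (fun r => formOp (ballRatio hS t r)) (𝓝[>] 0) (𝓝 (opDensity hS t)) := by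
  -- Only finitely many polarization vectors enter, so a single null set serves for all of them.
  have h : ∀ᵐ t ∂(traceMeasure hS), ∀ i j (k : Fin 4), Tendsto (fun r => ballRatio hS t r
      (stdOrthonormalBasis ℂ E j + Complex.I ^ (k : ℕ) • stdOrthonormalBasis ℂ E i)) (𝓝[>] 0)
      (𝓝 ((quadMeasure hS (stdOrthonormalBasis ℂ E j
        + Complex.I ^ (k : ℕ) • stdOrthonormalBasis ℂ E i)).rnDeriv (traceMeasure hS) t).toReal) := by
    simp only [ae_all_iff]
    exact fun i j k => ae_tendsto_ballRatio hS _
  filter_upwards [h] with t ht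
  exact tendsto_formOp ht

/-- The ratios over small balls are forms of nonnegative operators at every point, and nonnegativity
is closed under limits. Differentiation of measures thus avoids choosing densities compatibly for
all vectors. -/
theorem ae_opDensity_nonneg : ∀ᵐ t ∂(traceMeasure hS), 0 ≤ opDensity hS t := by
  have : CompleteSpace E := FiniteDimensional.complete ℂ E
  filter_upwards [ae_tendsto_formOp_ballRatio hS] with t ht
  refine CStarAlgebra.isClosed_nonneg.mem_of_tendsto ht ?_
  filter_upwards [self_mem_nhdsWithin] with r hr
  exact (ContinuousLinearMap.nonneg_iff_isPositive _).2
    ((isForm_ballRatio hS t (le_of_lt hr)).isPositive_formOp fun x => ENNReal.toReal_nonneg)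

theorem ae_rnDeriv_eq (x : E) : ∀ᵐ t ∂(traceMeasure hS),
    ((quadMeasure hS x).rnDeriv (traceMeasure hS) t) =
      ENNReal.ofReal (⟪x, opDensity hS t x⟫_ℂ).re := by
  filter_upwards [ae_tendsto_formOp_ballRatio hS, ae_tendsto_ballRatio hS x,
    Measure.rnDeriv_lt_top (quadMeasure hS x) (traceMeasure hS)] with t h1 h2 h3
  have hc : Continuous fun A : E →L[ℂ] E => (⟪x, A x⟫_ℂ).re := by fun_prop
  have h4 := (hc.tendsto _).comp h1
  rw [← tendsto_nhds_unique_of_eventuallyEq h2 h4 ?_, ENNReal.ofReal_toReal h3.ne]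
  filter_upwards [self_mem_nhdsWithin] with r hr
  exact (isForm_ballRatio hS t (le_of_lt hr)).eq_formOp x

/-- The square root of the density. -/
def rootDensity (t : ℝ) : E →L[ℂ] E :=
  have : CompleteSpace E := FiniteDimensional.complete ℂ E
  CFC.sqrt (CFC.abs (opDensity hS t))

theorem stronglyMeasurable_rootDensity : StronglyMeasurable (rootDensity hS) := by
  have : CompleteSpace E := FiniteDimensional.complete ℂ E
  -- The square root is used where it is continuous, on nonnegative operators; inserting the
  -- absolute value gives a map continuous everywhere. It changes nothing almost everywhere.
  have hc : Continuous fun A : E →L[ℂ] E => CFC.sqrt (CFC.abs A) :=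
    CFC.continuousOn_sqrt.comp_continuous CFC.continuous_abs fun A => CFC.abs_nonneg A
  exact hc.comp_stronglyMeasurable (stronglyMeasurable_opDensity hS)

theorem ae_norm_rootDensity_sq : ∀ᵐ t ∂(traceMeasure hS), ∀ x,
    ‖rootDensity hS t x‖ ^ 2 = (⟪x, opDensity hS t x⟫_ℂ).re := by
  have : CompleteSpace E := FiniteDimensional.complete ℂ E
  filter_upwards [ae_opDensity_nonneg hS] with t ht x
  have h1 : rootDensity hS t = CFC.sqrt (opDensity hS t) := by
    rw [rootDensity, CFC.abs_of_nonneg _ ht]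
  have h2 : IsSelfAdjoint (CFC.sqrt (opDensity hS t)) :=
    IsSelfAdjoint.of_nonneg (CFC.sqrt_nonneg _)
  have h3 := CFC.sqrt_mul_sqrt_self (opDensity hS t) ht
  rw [h1, ← inner_self_eq_norm_sq (𝕜 := ℂ)]
  conv_rhs => rw [← h3]
  have h4 := h2.isSymmetric x (CFC.sqrt (opDensity hS t) x)
  exact congrArg Complex.re h4

theorem quadMeasure_eq_withDensity (x : E) : quadMeasure hS x =
    (traceMeasure hS).withDensity fun t => ENNReal.ofReal (‖rootDensity hS t x‖ ^ 2) := by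
  rw [← Measure.withDensity_rnDeriv_eq _ _ (quadMeasure_absolutelyContinuous hS x)]
  refine withDensity_congr_ae ?_
  filter_upwards [ae_rnDeriv_eq hS x, ae_norm_rootDensity_sq hS] with t h1 h2
  rw [h1, h2]

end Density

/-! ### Multiplication by `t` in `L²` and its resolvent. -/

section Multiplication

variable {E : Type u} [NormedAddCommGroup E] [InnerProductSpace ℂ E] (μ : Measure ℝ)

theorem norm_inv_ofReal_sub_le {z : ℂ} (hz : z.im ≠ 0) (t : ℝ) :
    ‖((t : ℂ) - z)⁻¹‖ ≤ |z.im|⁻¹ := by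
  rw [norm_inv]
  refine inv_anti₀ (abs_pos.2 hz) ?_
  have := Complex.abs_im_le_norm ((t : ℂ) - z)
  simpa using this

variable {μ} in
theorem memLp_inv_smul {z : ℂ} (hz : z.im ≠ 0) (f : Lp E 2 μ) :
    MemLp (fun t : ℝ => ((t : ℂ) - z)⁻¹ • f t) 2 μ :=
  (Lp.memLp f).of_le_mul (c := |z.im|⁻¹)
    ((Measurable.aestronglyMeasurable (by fun_prop)).smul (Lp.aestronglyMeasurable f))
    (Filter.Eventually.of_forall fun t => by
      rw [norm_smul]
      exact mul_le_mul_of_nonneg_right (norm_inv_ofReal_sub_le hz t) (norm_nonneg _))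

/-- Multiplication by the function `1 / (t - z)` on `L²`. -/
def mulResolvent (z : ℂ) (hz : z.im ≠ 0) : Lp E 2 μ →L[ℂ] Lp E 2 μ :=
  LinearMap.mkContinuous
    { toFun := fun f => (memLp_inv_smul hz f).toLp
      map_add' := fun f g => by
        rw [← MemLp.toLp_add]
        refine MemLp.toLp_congr _ _ ?_
        filter_upwards [Lp.coeFn_add f g] with t ht
        rw [ht, Pi.add_apply, Pi.add_apply, smul_add]
      map_smul' := fun c f => by
        rw [RingHom.id_apply, ← MemLp.toLp_const_smul]
        refine MemLp.toLp_congr _ _ ?_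
        filter_upwards [Lp.coeFn_smul c f] with t ht
        rw [ht, Pi.smul_apply, Pi.smul_apply, smul_comm c] }
    |z.im|⁻¹ fun f => by
      refine Lp.norm_le_mul_norm_of_ae_le_mul ?_
      filter_upwards [(memLp_inv_smul hz f).coeFn_toLp] with t ht
      simp only [LinearMap.coe_mk, AddHom.coe_mk]
      rw [ht, norm_smul]
      exact mul_le_mul_of_nonneg_right (norm_inv_ofReal_sub_le hz t) (norm_nonneg _)

theorem coeFn_mulResolvent (z : ℂ) (hz : z.im ≠ 0) (f : Lp E 2 μ) :
    mulResolvent μ z hz f =ᵐ[μ] fun t : ℝ => ((t : ℂ) - z)⁻¹ • f t :=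
  MemLp.coeFn_toLp (memLp_inv_smul hz f)

variable (E) in
/-- The graph of the multiplication by the independent variable in `L²`. -/
def mulGraph : Submodule ℂ (Lp E 2 μ × Lp E 2 μ) where
  carrier := {p | p.2 =ᵐ[μ] fun t : ℝ => (t : ℂ) • p.1 t}
  zero_mem' := by
    have : ((0 : Lp E 2 μ) : ℝ → E) =ᵐ[μ] 0 := Lp.coeFn_zero E 2 μ
    simp only [Set.mem_ofPred_eq, Prod.snd_zero, Prod.fst_zero]
    filter_upwards [this] with t ht
    rw [ht, Pi.zero_apply, smul_zero]
  add_mem' := by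
    intro p q hp hq
    simp only [Set.mem_ofPred_eq, Prod.snd_add, Prod.fst_add] at hp hq ⊢
    filter_upwards [hp, hq, Lp.coeFn_add p.1 q.1, Lp.coeFn_add p.2 q.2] with t h1 h2 h3 h4
    rw [h3, h4, Pi.add_apply, Pi.add_apply, h1, h2, smul_add]
  smul_mem' := by
    intro c p hp
    simp only [Set.mem_ofPred_eq, Prod.smul_snd, Prod.smul_fst] at hp ⊢
    filter_upwards [hp, Lp.coeFn_smul c p.1, Lp.coeFn_smul c p.2] with t h1 h3 h4
    rw [h3, h4, Pi.smul_apply, Pi.smul_apply, h1, smul_comm c]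

theorem mem_mulGraph {f g : Lp E 2 μ} :
    (f, g) ∈ mulGraph E μ ↔ g =ᵐ[μ] fun t : ℝ => (t : ℂ) • f t := Iff.rfl

theorem ofReal_sub_ne_zero {z : ℂ} (hz : z.im ≠ 0) (t : ℝ) : (t : ℂ) - z ≠ 0 := fun h => hz (by
  rw [sub_eq_zero] at h
  rw [← h, Complex.ofReal_im])

theorem mulResolvent_mem_graph {z : ℂ} (hz : z.im ≠ 0) (f : Lp E 2 μ) :
    (mulResolvent μ z hz f, f + z • mulResolvent μ z hz f) ∈ mulGraph E μ := by
  rw [mem_mulGraph]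
  filter_upwards [coeFn_mulResolvent μ z hz f, Lp.coeFn_add f (z • mulResolvent μ z hz f),
    Lp.coeFn_smul z (mulResolvent μ z hz f)] with t h1 h2 h3
  rw [h2, Pi.add_apply, h3, Pi.smul_apply, h1]
  have := ofReal_sub_ne_zero hz t
  rw [smul_smul, smul_smul, ← eq_sub_iff_add_eq, ← sub_smul, ← sub_mul, mul_inv_cancel₀ this,
    one_smul]

theorem mulResolvent_left_inv {z : ℂ} (hz : z.im ≠ 0) {a b : Lp E 2 μ}
    (hab : (a, b) ∈ mulGraph E μ) : mulResolvent μ z hz (b - z • a) = a := by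
  rw [mem_mulGraph] at hab
  refine Lp.ext ?_
  filter_upwards [coeFn_mulResolvent μ z hz (b - z • a), Lp.coeFn_sub b (z • a),
    Lp.coeFn_smul z a, hab] with t h1 h2 h3 h4
  rw [h1, h2, Pi.sub_apply, h3, Pi.smul_apply, h4, ← sub_smul, smul_smul,
    inv_mul_cancel₀ (ofReal_sub_ne_zero hz t), one_smul]

theorem inner_mulResolvent {z : ℂ} (hz : z.im ≠ 0) (hz' : (conj z).im ≠ 0) (f g : Lp E 2 μ) :
    ⟪mulResolvent μ z hz f, g⟫_ℂ = ⟪f, mulResolvent μ (conj z) hz' g⟫_ℂ := by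
  rw [L2.inner_def, L2.inner_def]
  refine integral_congr_ae ?_
  filter_upwards [coeFn_mulResolvent μ z hz f, coeFn_mulResolvent μ _ hz' g] with t h1 h2
  simp [h1, h2, inner_smul_left, inner_smul_right]

theorem inner_mulGraph {a b y v : Lp E 2 μ} (hab : (a, b) ∈ mulGraph E μ)
    (h : (y, v) ∈ mulGraph E μ) : ⟪b, y⟫_ℂ = ⟪a, v⟫_ℂ := by
  rw [mem_mulGraph] at h hab
  rw [L2.inner_def, L2.inner_def]
  refine integral_congr_ae ?_
  filter_upwards [h, hab] with t h1 h2
  rw [h1, h2, inner_smul_left, inner_smul_right, Complex.conj_ofReal]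

/-- Maximality comes from the resolvents at `±i`: testing on the range of the resolvent at `i` gives
`y = R(v + iy)` with `R` the resolvent at `-i`, and such pairs lie in the graph. -/
theorem mem_mulGraph_of_inner {y v : Lp E 2 μ}
    (h : ∀ a b, (a, b) ∈ mulGraph E μ → ⟪b, y⟫_ℂ = ⟪a, v⟫_ℂ) : (y, v) ∈ mulGraph E μ := by
  have hi : Complex.I.im ≠ 0 := by simp
  have hi' : (conj Complex.I).im ≠ 0 := by simp
  have h1 : mulResolvent μ (conj Complex.I) hi' (v - conj Complex.I • y) = y := by
    refine ext_inner_left ℂ fun f => ?_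
    have h2 := h _ _ (mulResolvent_mem_graph μ hi f)
    rw [← inner_mulResolvent μ hi, inner_sub_right, ← h2, inner_smul_right, inner_add_left,
      inner_smul_left]
    ring
  have h3 := mulResolvent_mem_graph μ hi' (v - conj Complex.I • y)
  rwa [h1, sub_add_cancel] at h3

variable (E) in
/-- Multiplication by the independent variable in `L²`. -/
def mulOp : Lp E 2 μ →ₗ.[ℂ] Lp E 2 μ := (mulGraph E μ).toLinearPMap

theorem graph_mulOp : (mulOp E μ).graph = mulGraph E μ := by
  refine Submodule.toLinearPMap_graph_eq _ fun p hp h0 => ?_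
  have hp' : p.2 =ᵐ[μ] fun t : ℝ => (t : ℂ) • p.1 t := hp
  refine Lp.ext ?_
  have h1 : (p.1 : ℝ → E) =ᵐ[μ] 0 := by rw [h0]; exact Lp.coeFn_zero E 2 μ
  filter_upwards [hp', h1, Lp.coeFn_zero E 2 μ] with t h2 h3 h4
  rw [h2, h3, h4]; simp

theorem eq_zero_of_inner_mulGraph {y : Lp E 2 μ}
    (hy : ∀ a b, (a, b) ∈ mulGraph E μ → ⟪a, y⟫_ℂ = 0) : y = 0 := by
  have hi : Complex.I.im ≠ 0 := by simp
  have hi' : (conj Complex.I).im ≠ 0 := by simp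
  have h1 : mulResolvent μ (conj Complex.I) hi' y = 0 := by
    refine ext_inner_left ℂ fun f => ?_
    rw [← inner_mulResolvent μ hi, inner_zero_right]
    exact hy _ _ (mulResolvent_mem_graph μ hi f)
  have h2 := mulResolvent_mem_graph μ hi' y
  rw [h1, mem_mulGraph] at h2
  refine Lp.ext ?_
  filter_upwards [h2, Lp.coeFn_zero E 2 μ] with t h3 h4
  simp only [smul_zero, add_zero] at h3
  rw [h3, h4]; simp

theorem isSelfAdjoint_mulOp [CompleteSpace E] : IsSelfAdjoint (mulOp E μ) := by
  have hgr : ∀ {a b}, (a, b) ∈ (mulOp E μ).graph ↔ (a, b) ∈ mulGraph E μ := fun {a b} => by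
    rw [graph_mulOp]
  exact isSelfAdjoint_of_graph
    (fun _ _ _ _ hab hyv => inner_mulGraph μ (hgr.1 hab) (hgr.1 hyv))
    (fun _ _ h => hgr.2 (mem_mulGraph_of_inner μ fun a b hab => h a b (hgr.2 hab)))
    (fun _ h => eq_zero_of_inner_mulGraph μ fun a b hab => h a b (hgr.2 hab))

end Multiplication

/-! ### Regular and singular vectors of the weight `β`. -/

section Vectors

variable {E : Type u} [NormedAddCommGroup E] [InnerProductSpace ℂ E]
  {μ : Measure ℝ} {β : ℝ → E →L[ℂ] E}

/-- `β` is square integrable with weight `1 / (1 + t²)`. -/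
structure NevanlinnaWeight (μ : Measure ℝ) (β : ℝ → E →L[ℂ] E) : Prop where
  meas : StronglyMeasurable β
  integrable : ∀ e, Integrable (fun t => ‖β t e‖ ^ 2 / (1 + t ^ 2)) μ

theorem NevanlinnaWeight.meas_apply (hβ : NevanlinnaWeight μ β) (e : E) :
    StronglyMeasurable fun t => β t e :=
  (ContinuousLinearMap.apply ℂ E e).continuous.comp_stronglyMeasurable hβ.meas

/-- A multiplier that is `O(1 / √(1 + t²))`. -/
structure IsDecaying (c : ℝ → ℂ) : Prop where
  meas : Measurable c
  bound : ∃ C : ℝ, ∀ t, ‖c t‖ ^ 2 ≤ C / (1 + t ^ 2)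

theorem NevanlinnaWeight.memLp (hβ : NevanlinnaWeight μ β) {c : ℝ → ℂ} (hc : IsDecaying c) (e : E) :
    MemLp (fun t => c t • β t e) 2 μ := by
  have hm : AEStronglyMeasurable (fun t => c t • β t e) μ :=
    hc.meas.aestronglyMeasurable.smul (hβ.meas_apply e).aestronglyMeasurable
  rw [memLp_two_iff_integrable_sq_norm hm]
  obtain ⟨C, hC⟩ := hc.bound
  refine ((hβ.integrable e).const_mul C).mono' (by fun_prop) (Filter.Eventually.of_forall fun t => ?_)
  rw [Real.norm_of_nonneg (by positivity), norm_smul, mul_pow]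
  calc ‖c t‖ ^ 2 * ‖β t e‖ ^ 2 ≤ C / (1 + t ^ 2) * ‖β t e‖ ^ 2 := by gcongr; exact hC t
    _ = C * (‖β t e‖ ^ 2 / (1 + t ^ 2)) := by ring

/-- The vectors `e` for which `β e` is square integrable. -/
def regular (μ : Measure ℝ) (β : ℝ → E →L[ℂ] E) : Submodule ℂ E where
  carrier := {e | MemLp (fun t => β t e) 2 μ}
  zero_mem' := by simp
  add_mem' := fun h h' => by
    simp only [Set.mem_ofPred_eq, map_add] at h h' ⊢
    exact h.add h'
  smul_mem' := fun c _ h => by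
    simp only [Set.mem_ofPred_eq, map_smul] at h ⊢
    exact h.const_smul c

theorem memLp_of_mem_regular (e : regular μ β) : MemLp (fun t => β t e) 2 μ := e.2

variable [FiniteDimensional ℂ E]

/-- The operator `e ↦ c(t) β(t) e` from `E` into `L²`. -/
def NevanlinnaWeight.vec (hβ : NevanlinnaWeight μ β) {c : ℝ → ℂ} (hc : IsDecaying c) :
    E →L[ℂ] Lp E 2 μ :=
  LinearMap.toContinuousLinearMap
    { toFun := fun e => (hβ.memLp hc e).toLp
      map_add' := fun e e' => by
        rw [← MemLp.toLp_add]
        exact MemLp.toLp_congr _ _ (Filter.Eventually.of_forall fun t => by simp)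
      map_smul' := fun a e => by
        rw [RingHom.id_apply, ← MemLp.toLp_const_smul]
        exact MemLp.toLp_congr _ _ (Filter.Eventually.of_forall fun t => by simp [smul_comm a]) }

theorem NevanlinnaWeight.coeFn_vec (hβ : NevanlinnaWeight μ β) {c : ℝ → ℂ} (hc : IsDecaying c)
    (e : E) : hβ.vec hc e =ᵐ[μ] fun t => c t • β t e :=
  MemLp.coeFn_toLp (hβ.memLp hc e)

/-- The operator `e ↦ β(t) e` from the regular vectors into `L²`. -/
def regularVec (μ : Measure ℝ) (β : ℝ → E →L[ℂ] E) : regular μ β →L[ℂ] Lp E 2 μ :=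
  LinearMap.toContinuousLinearMap
    { toFun := fun e => (memLp_of_mem_regular e).toLp
      map_add' := fun e e' => by
        rw [← MemLp.toLp_add]
        exact MemLp.toLp_congr _ _ (Filter.Eventually.of_forall fun t => by simp)
      map_smul' := fun a e => by
        rw [RingHom.id_apply, ← MemLp.toLp_const_smul]
        exact MemLp.toLp_congr _ _ (Filter.Eventually.of_forall fun t => by simp) }

theorem coeFn_regularVec (e : regular μ β) :
    regularVec μ β e =ᵐ[μ] fun t => β t e :=
  MemLp.coeFn_toLp (memLp_of_mem_regular e)

/-- The multiplier `t / (1 + t²)`. -/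
def oddWeight (t : ℝ) : ℂ := (t : ℂ) / (1 + (t : ℂ) ^ 2)

/-- The multiplier `1 / (1 + t²)`. -/
def evenWeight (t : ℝ) : ℂ := 1 / (1 + (t : ℂ) ^ 2)

theorem isDecaying_oddWeight : IsDecaying oddWeight := by
  refine ⟨by unfold oddWeight; fun_prop, 1, fun t => ?_⟩
  have : oddWeight t = ((t / (1 + t ^ 2) : ℝ) : ℂ) := by simp [oddWeight]
  rw [this, Complex.norm_real, Real.norm_eq_abs, sq_abs, div_pow, div_le_div_iff₀ (by positivity)
    (by positivity)]
  nlinarith [sq_nonneg t, sq_nonneg (t ^ 2)]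

theorem isDecaying_evenWeight : IsDecaying evenWeight := by
  refine ⟨by unfold evenWeight; fun_prop, 1, fun t => ?_⟩
  have : evenWeight t = ((1 / (1 + t ^ 2) : ℝ) : ℂ) := by simp [evenWeight]
  rw [this, Complex.norm_real, Real.norm_eq_abs, sq_abs, div_pow, div_le_div_iff₀ (by positivity)
    (by positivity)]
  nlinarith [sq_nonneg t, sq_nonneg (t ^ 2)]

theorem one_add_sq_ne_zero (t : ℝ) : (1 : ℂ) + (t : ℂ) ^ 2 ≠ 0 := by
  have : (1 : ℂ) + (t : ℂ) ^ 2 = ((1 + t ^ 2 : ℝ) : ℂ) := by push_cast; rfl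
  rw [this, Ne, Complex.ofReal_eq_zero]
  positivity

theorem conj_oddWeight (t : ℝ) : conj (oddWeight t) = oddWeight t := by simp [oddWeight]

theorem conj_evenWeight (t : ℝ) : conj (evenWeight t) = evenWeight t := by simp [evenWeight]

/-- This is the formal identity `T J n + J' n = βn`. -/
theorem mul_oddWeight_add_evenWeight (t : ℝ) : (t : ℂ) * oddWeight t + evenWeight t = 1 := by
  rw [oddWeight, evenWeight]
  field_simp [one_add_sq_ne_zero t]
  ring

/-- The resolvent applied to `J' n + z J n` is `k_z βn`: the renormalized kernel arises from the
singular directions. -/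
theorem nevanlinnaKernel_eq {z : ℂ} (hz : z.im ≠ 0) (t : ℝ) :
    ((t : ℂ) - z)⁻¹ * (evenWeight t + z * oddWeight t) = nevanlinnaKernel z t := by
  have h1 := ofReal_sub_ne_zero hz t
  have h2 := one_add_sq_ne_zero t
  rw [nevanlinnaKernel, oddWeight, evenWeight]
  field_simp
  ring

/-- Multiplication by the independent variable, with the singular directions `t β(t) n / (1 + t²)`,
next to a linear pencil on `E⁴`. -/
def nevanlinnaModel [CompleteSpace E] (hβ : NevanlinnaWeight μ β) {Q C : E →L[ℂ] E}
    (hQ : Q.IsSymmetric) (hC : C.IsSymmetric) :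
    RiggedModel (Lp E 2 μ) (regular μ β)ᗮ (PiLp 2 (fun _ : Fin 4 => E)) where
  T := mulOp E μ
  selfAdjoint := isSelfAdjoint_mulOp μ
  J := hβ.vec isDecaying_oddWeight ∘L (regular μ β)ᗮ.subtypeL
  J' := hβ.vec isDecaying_evenWeight ∘L (regular μ β)ᗮ.subtypeL
  inner_J_J' m n := by
    rw [L2.inner_def, L2.inner_def]
    refine integral_congr_ae ?_
    simp only [ContinuousLinearMap.comp_apply, Submodule.subtypeL_apply]
    filter_upwards [hβ.coeFn_vec isDecaying_oddWeight m, hβ.coeFn_vec isDecaying_oddWeight n,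
      hβ.coeFn_vec isDecaying_evenWeight m, hβ.coeFn_vec isDecaying_evenWeight n] with t h1 h2 h3 h4
    rw [h1, h2, h3, h4]
    simp only [inner_smul_left, inner_smul_right, conj_oddWeight, conj_evenWeight]
    ring
  singular n hn := by
    obtain ⟨v, hv⟩ := LinearPMap.mem_domain_iff.1 hn
    rw [graph_mulOp, mem_mulGraph] at hv
    -- If `J n ∈ dom T`, then `T J n + J' n = βn` is in `L²`, so `n` is regular as well as
    -- orthogonal to the regular vectors.
    have hreg : (n : E) ∈ regular μ β := by
      have h := (Lp.memLp (v + hβ.vec isDecaying_evenWeight n))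
      refine (memLp_congr_ae ?_).1 h
      filter_upwards [hv, Lp.coeFn_add v (hβ.vec isDecaying_evenWeight n),
        hβ.coeFn_vec isDecaying_oddWeight n, hβ.coeFn_vec isDecaying_evenWeight n] with t h1 h2 h3 h4
      rw [h2, Pi.add_apply, h1, h4]
      simp only [ContinuousLinearMap.comp_apply, Submodule.subtypeL_apply]
      rw [h3, smul_smul, ← add_smul, mul_oddWeight_add_evenWeight, one_smul]
    have h0 := (Submodule.mem_orthogonal _ _).1 n.2 _ hreg
    rw [inner_self_eq_zero] at h0
    exact Subtype.ext h0
  D₂ := linD Q C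
  symm_D₂ := linD_symm hQ hC
  F₂ := linF
  projection_F₂ := isStarProjection_linF

end Vectors

/-! ### The Nevanlinna integral and the transfer function of the `L²` part. -/

section Transfer

variable {E : Type u} [NormedAddCommGroup E] [InnerProductSpace ℂ E] [FiniteDimensional ℂ E]

theorem nevanlinnaWeight_rootDensity {S : ℝ → E →L[ℂ] E} {hS : IsNondecreasing S}
    (hfin : FiniteNevanlinnaMass hS) :
    NevanlinnaWeight (traceMeasure hS) (rootDensity hS) := by
  refine ⟨stronglyMeasurable_rootDensity hS, fun e => ?_⟩
  have hm : StronglyMeasurable fun t => rootDensity hS t e :=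
    (ContinuousLinearMap.apply ℂ E e).continuous.comp_stronglyMeasurable
      (stronglyMeasurable_rootDensity hS)
  have hm2 : Measurable fun t => ‖rootDensity hS t e‖ ^ 2 := hm.norm.measurable.pow_const 2
  refine ⟨(hm2.div (by fun_prop)).aestronglyMeasurable, ?_⟩
  rw [hasFiniteIntegral_iff_ofReal (Filter.Eventually.of_forall fun t => by positivity)]
  have h := hfin e
  rw [quadMeasure_eq_withDensity, lintegral_withDensity_eq_lintegral_mul _ (by fun_prop)
    (by fun_prop)] at h
  refine lt_of_eq_of_lt (lintegral_congr fun t => ?_) h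
  rw [Pi.mul_apply, ← ENNReal.ofReal_mul (by positivity), mul_one_div]

theorem exists_norm_nevanlinnaKernel_le {z : ℂ} (hz : z.im ≠ 0) :
    ∃ C : ℝ, ∀ t : ℝ, ‖nevanlinnaKernel z t‖ ≤ C / (1 + t ^ 2) := by
  refine ⟨‖z‖ + ‖1 + z ^ 2‖ * |z.im|⁻¹, fun t => ?_⟩
  have h1 := ofReal_sub_ne_zero hz t
  have h2 := one_add_sq_ne_zero t
  have h3 : nevanlinnaKernel z t = (z + (1 + z ^ 2) * ((t : ℂ) - z)⁻¹) / (1 + (t : ℂ) ^ 2) := by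
    rw [nevanlinnaKernel]
    field_simp
    ring
  have h4 : ‖(1 : ℂ) + (t : ℂ) ^ 2‖ = 1 + t ^ 2 := by
    have : (1 : ℂ) + (t : ℂ) ^ 2 = ((1 + t ^ 2 : ℝ) : ℂ) := by push_cast; rfl
    rw [this, Complex.norm_real, Real.norm_of_nonneg (by positivity)]
  rw [h3, norm_div, h4]
  gcongr
  refine (norm_add_le _ _).trans ?_
  rw [norm_mul]
  gcongr
  exact norm_inv_ofReal_sub_le hz t

theorem measurable_nevanlinnaKernel (z : ℂ) : Measurable (nevanlinnaKernel z) := by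
  unfold nevanlinnaKernel
  fun_prop

section Integral

variable {S : ℝ → E →L[ℂ] E} {hS : IsNondecreasing S} {φ : ℝ → ℂ}

theorem integral_quadMeasure (hβ : NevanlinnaWeight (traceMeasure hS) (rootDensity hS)) (x : E) :
    ∫ t, φ t ∂(quadMeasure hS x) =
      ∫ t, ((‖rootDensity hS t x‖ : ℂ) ^ 2) * φ t ∂(traceMeasure hS) := by
  have hm : Measurable fun t => ENNReal.ofReal (‖rootDensity hS t x‖ ^ 2) :=
    ((hβ.meas_apply x).norm.measurable.pow_const 2).ennreal_ofReal
  rw [quadMeasure_eq_withDensity, integral_withDensity_eq_integral_toReal_smul hm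
    (Filter.Eventually.of_forall fun t => ENNReal.ofReal_lt_top)]
  refine integral_congr_ae (Filter.Eventually.of_forall fun t => ?_)
  simp only
  rw [ENNReal.toReal_ofReal (by positivity), Complex.real_smul]
  push_cast
  rfl

theorem integral_polarization {μ : Measure ℝ} {f₁ f₂ f₃ f₄ : ℝ → ℂ} (h₁ : Integrable f₁ μ)
    (h₂ : Integrable f₂ μ) (h₃ : Integrable f₃ μ) (h₄ : Integrable f₄ μ) :
    (1 / 4 : ℂ) * ((∫ t, f₁ t ∂μ) - (∫ t, f₂ t ∂μ) + Complex.I * (∫ t, f₃ t ∂μ)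
      - Complex.I * (∫ t, f₄ t ∂μ)) =
    ∫ t, (1 / 4 : ℂ) * (f₁ t - f₂ t + Complex.I * f₃ t - Complex.I * f₄ t) ∂μ := by
  rw [integral_const_mul, integral_sub (f := fun t => f₁ t - f₂ t + Complex.I * f₃ t)
    ((h₁.sub h₂).add (h₃.const_mul _)) (h₄.const_mul _),
    integral_add (f := fun t => f₁ t - f₂ t) (h₁.sub h₂) (h₃.const_mul _), integral_sub h₁ h₂,
    integral_const_mul, integral_const_mul]

/-- Every quadratic measure has density `‖βx‖²` with respect to the same `μ`, so polarization can be
carried out under the integral. The decay of `φ` makes the four integrals converge. -/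
theorem sesqIntegral_eq (hβ : NevanlinnaWeight (traceMeasure hS) (rootDensity hS))
    (hφ : Measurable φ) {C : ℝ} (hC : ∀ t, ‖φ t‖ ≤ C / (1 + t ^ 2)) (x y : E) :
    sesqIntegral hS φ x y =
      ∫ t, φ t * ⟪rootDensity hS t y, rootDensity hS t x⟫_ℂ ∂(traceMeasure hS) := by
  have hint : ∀ x, Integrable (fun t => ((‖rootDensity hS t x‖ : ℂ) ^ 2) * φ t)
      (traceMeasure hS) := fun x => by
    have hm := hβ.meas_apply x
    refine ((hβ.integrable x).const_mul C).mono' (by fun_prop)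
      (Filter.Eventually.of_forall fun t => ?_)
    rw [norm_mul, norm_pow, Complex.norm_real, norm_norm]
    calc _ ≤ ‖rootDensity hS t x‖ ^ 2 * (C / (1 + t ^ 2)) := by gcongr; exact hC t
      _ = _ := by ring
  rw [sesqIntegral]
  simp only [integral_quadMeasure hβ]
  rw [integral_polarization (hint _) (hint _) (hint _) (hint _)]
  refine integral_congr_ae (Filter.Eventually.of_forall fun t => ?_)
  simp only [map_add, map_sub, map_smul]
  rw [← inner_conj_symm, inner_eq_sum_norm_sq_div_four (𝕜 := ℂ)]
  simp only [RCLike.I_to_complex, map_div₀, map_add, map_sub, map_mul, map_pow, Complex.conj_I,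
    Complex.coe_algebraMap, Complex.conj_ofReal, map_ofNat]
  ring

theorem inner_opIntegral (hβ : NevanlinnaWeight (traceMeasure hS) (rootDensity hS))
    (hφ : Measurable φ) {C : ℝ} (hC : ∀ t, ‖φ t‖ ≤ C / (1 + t ^ 2)) (x y : E) :
    ⟪opIntegral hS φ x, y⟫_ℂ =
      ∫ t, conj (φ t) * ⟪rootDensity hS t x, rootDensity hS t y⟫_ℂ ∂(traceMeasure hS) := by
  have : CompleteSpace E := FiniteDimensional.complete ℂ E
  -- The factors satisfy `φ = w c`, and each is `O(1/√(1 + t²))`. The form is then `(wβ)*(cβ)`, a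
  -- genuine operator, so its basis expansion recovers it.
  let w : ℝ → ℂ := fun t => ((Real.sqrt (1 + t ^ 2))⁻¹ : ℝ)
  let c : ℝ → ℂ := fun t => φ t * ((Real.sqrt (1 + t ^ 2) : ℝ) : ℂ)
  have hw : IsDecaying w := by
    refine ⟨by fun_prop, 1, fun t => ?_⟩
    simp only [w]
    rw [Complex.norm_real, Real.norm_eq_abs, sq_abs, inv_pow, Real.sq_sqrt (by positivity), one_div]
  have hc : IsDecaying c := by
    refine ⟨by fun_prop, C ^ 2, fun t => ?_⟩
    simp only [c]
    rw [norm_mul, Complex.norm_real, Real.norm_eq_abs, mul_pow, sq_abs, Real.sq_sqrt (by positivity)]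
    calc ‖φ t‖ ^ 2 * (1 + t ^ 2) ≤ (C / (1 + t ^ 2)) ^ 2 * (1 + t ^ 2) := by gcongr; exact hC t
      _ = C ^ 2 / (1 + t ^ 2) := by field_simp
  have hs : ∀ x y, sesqIntegral hS φ x y =
      ⟪y, (ContinuousLinearMap.adjoint (hβ.vec hw) ∘L hβ.vec hc) x⟫_ℂ := fun x y => by
    rw [sesqIntegral_eq hβ hφ hC, ContinuousLinearMap.comp_apply,
      ContinuousLinearMap.adjoint_inner_right, L2.inner_def]
    refine integral_congr_ae ?_
    filter_upwards [hβ.coeFn_vec hw y, hβ.coeFn_vec hc x] with t h1 h2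
    rw [h1, h2, inner_smul_left, inner_smul_right, ← mul_assoc]
    congr 1
    simp only [w, c, Complex.conj_ofReal]
    have : (Real.sqrt (1 + t ^ 2) : ℂ) ≠ 0 := by
      rw [Ne, Complex.ofReal_eq_zero]; positivity
    push_cast
    field_simp
  have hop : opIntegral hS φ = ContinuousLinearMap.adjoint (hβ.vec hw) ∘L hβ.vec hc := opOf_eq hs
  rw [hop, ← inner_conj_symm, ← hs, sesqIntegral_eq hβ hφ hC, ← integral_conj]
  refine integral_congr_ae (Filter.Eventually.of_forall fun t => ?_)
  simp only [map_mul, inner_conj_symm]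

end Integral

variable {μ : Measure ℝ} {β : ℝ → E →L[ℂ] E}

/-- The regular part `e ↦ β(t) r` of the input, where `r` is the projection of `e` on the regular
vectors. -/
def regInput (μ : Measure ℝ) (β : ℝ → E →L[ℂ] E) : E →L[ℂ] Lp E 2 μ :=
  regularVec μ β ∘L (regular μ β).orthogonalProjectionOnto

theorem regular_add_singular (e : E) : ((regular μ β).orthogonalProjectionOnto e : E)
    + ((regular μ β)ᗮ.orthogonalProjectionOnto e : E) = e :=
  (regular μ β).starProjection_add_starProjection_orthogonal e

/-- The constant term produced by the regular part of the input. -/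
def regConst [CompleteSpace E] (hβ : NevanlinnaWeight μ β) : E →L[ℂ] E :=
  ContinuousLinearMap.adjoint (regInput μ β) ∘L hβ.vec isDecaying_oddWeight
    + ContinuousLinearMap.adjoint (hβ.vec isDecaying_oddWeight ∘L (regular μ β)ᗮ.subtypeL ∘L
      (regular μ β)ᗮ.orthogonalProjectionOnto) ∘L regInput μ β

theorem inner_regConst [CompleteSpace E] (hβ : NevanlinnaWeight μ β) (e e' : E) :
    ⟪regConst hβ e, e'⟫_ℂ = ⟪hβ.vec isDecaying_oddWeight e, regInput μ β e'⟫_ℂ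
      + ⟪regInput μ β e, hβ.vec isDecaying_oddWeight
        ((regular μ β)ᗮ.orthogonalProjectionOnto e' : E)⟫_ℂ := by
  simp only [regConst, add_apply, inner_add_left, ContinuousLinearMap.comp_apply,
    ContinuousLinearMap.adjoint_inner_left, Submodule.subtypeL_apply]

theorem inner_vec_regInput (hβ : NevanlinnaWeight μ β) (e e' : E) :
    ⟪hβ.vec isDecaying_oddWeight ((regular μ β).orthogonalProjectionOnto e : E),
      regInput μ β e'⟫_ℂ = ⟪regInput μ β e,
        hβ.vec isDecaying_oddWeight ((regular μ β).orthogonalProjectionOnto e' : E)⟫_ℂ := by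
  rw [L2.inner_def, L2.inner_def]
  refine integral_congr_ae ?_
  simp only [regInput, ContinuousLinearMap.comp_apply]
  filter_upwards [hβ.coeFn_vec isDecaying_oddWeight ((regular μ β).orthogonalProjectionOnto e : E),
    hβ.coeFn_vec isDecaying_oddWeight ((regular μ β).orthogonalProjectionOnto e' : E),
    coeFn_regularVec (μ := μ) (β := β) ((regular μ β).orthogonalProjectionOnto e),
    coeFn_regularVec (μ := μ) (β := β) ((regular μ β).orthogonalProjectionOnto e')] with t h1 h2 h3 h4
  rw [h1, h2, h3, h4, inner_smul_left, inner_smul_right, conj_oddWeight]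

/-- The form is the integral of `t/(1+t²)` against `(βe, βe')` with only the singular–singular block
removed, and this omission is symmetric in `e` and `e'`. -/
theorem isSymmetric_regConst [CompleteSpace E] (hβ : NevanlinnaWeight μ β) :
    (regConst hβ).IsSymmetric := by
  intro e e'
  change ⟪regConst hβ e, e'⟫_ℂ = ⟪e, regConst hβ e'⟫_ℂ
  rw [← inner_conj_symm e, inner_regConst, inner_regConst, map_add, inner_conj_symm,
    inner_conj_symm]
  have h1 : ∀ e : E, hβ.vec isDecaying_oddWeight e =
      hβ.vec isDecaying_oddWeight ((regular μ β).orthogonalProjectionOnto e : E)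
      + hβ.vec isDecaying_oddWeight ((regular μ β)ᗮ.orthogonalProjectionOnto e : E) := fun e => by
    rw [← map_add, regular_add_singular]
  rw [h1 e, h1 e', inner_add_left, inner_add_right, inner_vec_regInput]
  ring

/-- The contribution of `L²` to the transfer function of the model is
`regConst + ∫ (1/(t-z) - t/(1+t²)) β*β dμ`. -/
theorem inner_nevanlinnaModel (hβ : NevanlinnaWeight μ β) {z : ℂ} (hz : z.im ≠ 0) (e e' : E)
    {n n' : E} (hn : n = ((regular μ β)ᗮ.orthogonalProjectionOnto e : E))
    (hn' : n' = ((regular μ β)ᗮ.orthogonalProjectionOnto e' : E)) {u a b : Lp E 2 μ}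
    (hu : u = regInput μ β e + hβ.vec isDecaying_evenWeight n
      + z • hβ.vec isDecaying_oddWeight n)
    (ha : a = mulResolvent μ z hz u) (hb : b = u + z • a) :
    ⟪a + hβ.vec isDecaying_oddWeight n, regInput μ β e'⟫_ℂ
        + ⟪b, hβ.vec isDecaying_oddWeight n'⟫_ℂ + ⟪a, hβ.vec isDecaying_evenWeight n'⟫_ℂ =
      (∫ t, conj (nevanlinnaKernel z t) * ⟪β t e, β t e'⟫_ℂ ∂μ)
        + (⟪hβ.vec isDecaying_oddWeight e, regInput μ β e'⟫_ℂ
          + ⟪regInput μ β e, hβ.vec isDecaying_oddWeight n'⟫_ℂ) := by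
  have hgr : b =ᵐ[μ] fun t : ℝ => (t : ℂ) • a t := by
    have := mulResolvent_mem_graph μ hz u
    rw [← ha, ← hb] at this
    exact this
  rw [← sub_eq_iff_eq_add]
  simp only [L2.inner_def]
  rw [← integral_add (L2.integrable_inner _ _) (L2.integrable_inner _ _),
    ← integral_add ((L2.integrable_inner _ _).add (L2.integrable_inner _ _))
      (L2.integrable_inner _ _),
    ← integral_add (L2.integrable_inner _ _) (L2.integrable_inner _ _),
    ← integral_sub (((L2.integrable_inner _ _).add (L2.integrable_inner _ _)).add
      (L2.integrable_inner _ _)) ((L2.integrable_inner _ _).add (L2.integrable_inner _ _))]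
  refine integral_congr_ae ?_
  have hB : ∀ e, regInput μ β e =ᵐ[μ] fun t => β t ((regular μ β).orthogonalProjectionOnto e) :=
    fun e => coeFn_regularVec _
  have ha' : a =ᵐ[μ] fun t : ℝ => ((t : ℂ) - z)⁻¹ • u t := by
    rw [ha]; exact coeFn_mulResolvent μ z hz u
  have hu' : u =ᵐ[μ] fun t => β t ((regular μ β).orthogonalProjectionOnto e)
      + (evenWeight t + z * oddWeight t) • β t n := by
    rw [hu]
    filter_upwards [hB e, hβ.coeFn_vec isDecaying_evenWeight n, hβ.coeFn_vec isDecaying_oddWeight n,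
      Lp.coeFn_add (regInput μ β e + hβ.vec isDecaying_evenWeight n)
        (z • hβ.vec isDecaying_oddWeight n),
      Lp.coeFn_add (regInput μ β e) (hβ.vec isDecaying_evenWeight n),
      Lp.coeFn_smul z (hβ.vec isDecaying_oddWeight n)] with t h1 h2 h3 h4 h5 h6
    rw [h4, Pi.add_apply, h5, Pi.add_apply, h6, Pi.smul_apply, h1, h2, h3, add_smul, smul_smul,
      add_assoc]
  filter_upwards [hgr, ha', hu', hB e, hB e', Lp.coeFn_add a (hβ.vec isDecaying_oddWeight n),
    hβ.coeFn_vec isDecaying_oddWeight n, hβ.coeFn_vec isDecaying_oddWeight n',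
    hβ.coeFn_vec isDecaying_evenWeight n', hβ.coeFn_vec isDecaying_oddWeight e]
    with t h1 h2 h3 h4 h5 h6 h7 h8 h9 h10
  -- The identity is now pointwise. The first slot satisfies `a + J n = βe/(t - z)`, and
  -- `t·oddWeight + evenWeight = 1` merges the two singular output terms into `⟪a, βn'⟫`. Every
  -- block then carries `k_z`, plus `oddWeight` unless both vectors are singular.
  have he : β t e = β t ((regular μ β).orthogonalProjectionOnto e) + β t n := by
    rw [hn, ← map_add, regular_add_singular]
  have he' : β t e' = β t ((regular μ β).orthogonalProjectionOnto e') + β t n' := by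
    rw [hn', ← map_add, regular_add_singular]
  rw [h6, Pi.add_apply, h7, h1, h8, h9, h10, h4, h5, h2, h3, he, he', smul_add, smul_smul,
    nevanlinnaKernel_eq hz]
  have hk : nevanlinnaKernel z t = ((t : ℂ) - z)⁻¹ - oddWeight t := by
    rw [nevanlinnaKernel, oddWeight, one_div]
  have hs : ((t : ℂ) - z)⁻¹ = nevanlinnaKernel z t + oddWeight t := by rw [hk]; ring
  have hw := mul_oddWeight_add_evenWeight t
  rw [hs]
  generalize nevanlinnaKernel z t = k
  generalize β t n = y
  generalize β t n' = y'
  generalize β t ((regular μ β).orthogonalProjectionOnto e) = x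
  generalize β t ((regular μ β).orthogonalProjectionOnto e') = x'
  simp only [inner_add_left, inner_add_right, inner_smul_left, inner_smul_right, map_add,
    conj_oddWeight, Complex.conj_ofReal, smul_add]
  linear_combination (conj k * ⟪x, y'⟫_ℂ + oddWeight t * ⟪x, y'⟫_ℂ + conj k * ⟪y, y'⟫_ℂ) * hw

end Transfer

end Realization

end

/-! ### Assembly of the realization. -/

theorem theorem3p5 {E : Type u} [NormedAddCommGroup E] [InnerProductSpace ℂ E]
    [FiniteDimensional ℂ E] (Q L : E →L[ℂ] E) (hQ : Q.IsSymmetric) (hL : L.IsPositive)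
    (S : ℝ → E →L[ℂ] E) (hS : IsNondecreasing S) (hfin : FiniteNevanlinnaMass hS)
    (V : ℂ → E →L[ℂ] E)
    (hV : ∀ z : ℂ, z.im ≠ 0 → V z = Q + z • L + opIntegral hS (nevanlinnaKernel z)) :
    ∃ (H : Type u) (_ : NormedAddCommGroup H) (_ : InnerProductSpace ℂ H) (_ : CompleteSpace H)
      (A : H →ₗ.[ℂ] H) (D : HPlus A →L[ℂ] HMinus A) (F : HPlus A →L[ℂ] HPlus A)
      (K : E →L[ℂ] HMinus A),
      IsDeltaPlusSystem A D F K ∧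
        ∀ z : ℂ, z.im ≠ 0 → z ∈ rho D F K ∧ ∀ e : E, V z e = transfer D F K z e := by
  have : CompleteSpace E := FiniteDimensional.complete ℂ E
  have hβ := nevanlinnaWeight_rootDensity hfin
  set μ := traceMeasure hS with hμ
  set β := rootDensity hS with hβd
  have hL0 : 0 ≤ L := (ContinuousLinearMap.nonneg_iff_isPositive L).2 hL
  have hCC : CFC.sqrt L * CFC.sqrt L = L := CFC.sqrt_mul_sqrt_self L hL0
  have hC : (CFC.sqrt L).IsSymmetric := (IsSelfAdjoint.of_nonneg (CFC.sqrt_nonneg L)).isSymmetric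
  -- The correction cancels the constant which the regular inputs add to the `L²` part.
  have hQ' : (Q - regConst hβ).IsSymmetric := hQ.sub (isSymmetric_regConst hβ)
  let M := nevanlinnaModel hβ hQ' hC
  have hinv : ∀ z : ℂ, ∃ S : PiLp 2 (fun _ : Fin 4 => E) →L[ℂ] PiLp 2 (fun _ : Fin 4 => E),
      ∀ w, M.D₂ (S w) - z • M.F₂ (S w) = w := fun z => ⟨linInv _ _ z, linD_linInv _ _ z⟩
  refine ⟨WithLp 2 (Lp E 2 μ × PiLp 2 (fun _ : Fin 4 => E)), inferInstance, inferInstance,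
    inferInstance, M.A, M.D, M.F,
    M.K (regInput μ β) linK (regular μ β)ᗮ.orthogonalProjectionOnto,
    M.isDeltaPlusSystem _ _ _ hinv linK_injective, fun z hz => ?_⟩
  have hR : M.IsResolvent z (mulResolvent μ z hz) := by
    constructor
    · intro y
      change _ ∈ (mulOp E μ).graph
      rw [graph_mulOp]
      exact mulResolvent_mem_graph μ hz y
    · intro a b hab
      change _ ∈ (mulOp E μ).graph at hab
      rw [graph_mulOp] at hab
      exact mulResolvent_left_inv μ hz hab
  refine ⟨(M.mem_rho_iff _ _ _ hinv z).2 ⟨_, hR⟩, fun e => ext_inner_right ℂ fun e' => ?_⟩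
  obtain ⟨C, hC⟩ := exists_norm_nevanlinnaKernel_le hz
  rw [M.inner_transfer (regInput μ β) linK (regular μ β)ᗮ.orthogonalProjectionOnto hinv hR
    (linD_linInv (Q - regConst hβ) (CFC.sqrt L) z (linK e)) (hR.graph_mem _)
    (add_sub_cancel_right _ _), inner_linInv_linK]
  have hmain := inner_nevanlinnaModel hβ hz e e' rfl rfl rfl rfl rfl
  have hCL : CFC.sqrt L (CFC.sqrt L e) = L e := DFunLike.congr_fun hCC e
  have hreg := inner_regConst hβ e e'
  have hop := inner_opIntegral hβ (measurable_nevanlinnaKernel z) hC e e'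
  refine Eq.symm ((congrArg (fun c => c + ⟪(Q - regConst hβ) e
    + z • CFC.sqrt L (CFC.sqrt L e), e'⟫_ℂ) hmain).trans ?_)
  rw [hV z hz, hCL]
  simp only [add_apply, sub_apply, smul_apply, inner_add_left, inner_sub_left]
  rw [hop, hreg]
  ring
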